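/- For $f\in L^2(\mathbb{R}^2)$ (complex-valued) let $e^{it\Delta}f$ denote the solution of the Schrödinger equation $\partial_t u=i\Delta u$ on $\mathbb{R}^2\times\mathbb{R}$ with initial data $u(\cdot,0)=f$, that is, $\widehat{e^{it\Delta}f}(\xi)=e^{-4\pi^2 it|\xi|^2}\widehat f(\xi)$ with $\widehat f(\xi)=\int f(x)e^{-2\pi i x\cdot\xi}\,dx$ (extended to $L^2$ by Plancherel). For every radial $f\in L^2(\mathbb{R}^2)$, $$\|e^{it\Delta}f(x)\|_{L^4(\mathbb{R}^3,\,dx\,dt)}\le 2^{-1/2}\,\|f\|_{L^2(\mathbb{R}^2)},$$ and equality is attained if and only if $f(x)=Ae^{-B|x|^2}$ (for almost every $x$) for some $A,B\in\mathbb{C}$ with $\operatorname{Re}B>0$. -/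

import Mathlib

open MeasureTheory FourierTransform
open scoped ENNReal

/-- The Fourier symbol `e^{-4π² i t |ξ|²}` of the operator `e^{itΔ}`, for the normalization
`𝓕 f ξ = ∫ f(x) e^{-2π i x·ξ} dx`. -/
noncomputable def schrodingerSymbol (d : ℕ) (t : ℝ) (ξ : EuclideanSpace ℝ (Fin d)) : ℂ :=
  Complex.exp (-(4 * (Real.pi : ℂ) ^ 2 * Complex.I * (t : ℂ) * ((‖ξ‖ : ℝ) : ℂ) ^ 2))

theorem norm_schrodingerSymbol (d : ℕ) (t : ℝ) (ξ : EuclideanSpace ℝ (Fin d)) :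
    ‖schrodingerSymbol d t ξ‖ = 1 := by
  have h : -(4 * (Real.pi : ℂ) ^ 2 * Complex.I * (t : ℂ) * ((‖ξ‖ : ℝ) : ℂ) ^ 2)
      = ((-(4 * Real.pi ^ 2 * t * ‖ξ‖ ^ 2) : ℝ) : ℂ) * Complex.I := by
    push_cast
    ring
  rw [schrodingerSymbol, h, Complex.norm_exp_ofReal_mul_I]

theorem continuous_schrodingerSymbol (d : ℕ) (t : ℝ) : Continuous (schrodingerSymbol d t) := by
  unfold schrodingerSymbol
  fun_prop

theorem memLp_schrodingerSymbol_mul (d : ℕ) (t : ℝ)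
    (g : Lp ℂ 2 (volume : Measure (EuclideanSpace ℝ (Fin d)))) :
    MemLp (fun ξ => schrodingerSymbol d t ξ * g ξ) 2 volume := by
  refine (Lp.memLp g).of_le
    ((continuous_schrodingerSymbol d t).aestronglyMeasurable.mul (Lp.aestronglyMeasurable g)) ?_
  filter_upwards with ξ
  rw [norm_mul, norm_schrodingerSymbol, one_mul]

/-- The Schrödinger propagator `e^{itΔ}` on `L²(ℝ^d)`: the Fourier multiplier with symbol
`e^{-4π² i t |ξ|²}`, where `𝓕` is the (Plancherel) Fourier transform on `L²`. -/
noncomputable def schrodingerPropagator {d : ℕ} (t : ℝ)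
    (f : Lp ℂ 2 (volume : Measure (EuclideanSpace ℝ (Fin d)))) :
    Lp ℂ 2 (volume : Measure (EuclideanSpace ℝ (Fin d))) :=
  𝓕⁻ ((memLp_schrodingerSymbol_mul d t (𝓕 f)).toLp (fun ξ => schrodingerSymbol d t ξ * (𝓕 f) ξ))

/-- `U` is the space-time function `(x, t) ↦ (e^{itΔ} f)(x)` on `ℝ^d × ℝ`: it is measurable for
`dx dt`, and its time slices are `e^{itΔ} f`. These conditions determine `U` up to `dx dt`-null
sets. -/
structure IsSchrodingerEvolution {d : ℕ}
    (f : Lp ℂ 2 (volume : Measure (EuclideanSpace ℝ (Fin d))))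
    (U : EuclideanSpace ℝ (Fin d) × ℝ → ℂ) : Prop where
  aestronglyMeasurable : AEStronglyMeasurable U volume
  slice : ∀ᵐ t : ℝ, (fun x => U (x, t)) =ᵐ[volume] schrodingerPropagator t f

/-- An `L²` function is radial if it agrees almost everywhere with a function of `‖x‖`. -/
def IsRadial {d : ℕ} (f : Lp ℂ 2 (volume : Measure (EuclideanSpace ℝ (Fin d)))) : Prop :=
  ∃ φ : ℝ → ℂ, f =ᵐ[volume] fun x => φ ‖x‖

/-!
The proof computes the space-time norm exactly, with a nonnegative remainder. Write `F = 𝓕 f` and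
`u = e^{itΔ} f`. At a fixed time the Fourier transform of `u²` is the convolution of `𝓕 u` with
itself; in the centre-of-mass coordinates `a = p/2 + q`, `b = p/2 - q` the parallelogram law
`|a|² + |b|² = |p|²/2 + 2|q|²` turns it, up to a phase depending on `p` and `t`, into
`∫ F(p/2 + q) F(p/2 - q) e^{-8π² i t |q|²} dq`. Plancherel in `x` followed by Plancherel in `t`, for
the variable dual to `s = |q|²`, expresses `‖u‖₄⁴` through the integrals of
`q ↦ F(p/2 + q) F(p/2 - q)` over the circles `|q|² = s`. The Cauchy-Schwarz inequality on each
circle is sharp with the variance as its remainder, which gives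
`four_mul_eLpNorm_evolution_add_defect`:

  `4 ‖u‖₄⁴ + ∫ (circular defect of q ↦ F(p/2 + q) F(p/2 - q)) dp = ‖f‖₂⁴`.

Plancherel is used as an identity in `[0, ∞]` for integrable functions
(`eLpNorm_two_fourier_of_integrable`), so nothing has to be known to be finite beforehand. The
inequality follows for every `f`, and equality means that for almost every `p` the
product `F(p/2 + q) F(p/2 - q)` is a radial function of `q`.

Gaussians have this property. Conversely, if `f` is radial then `F(x) = G(|x|²)`
(`exists_radial_profile_of_isRadial`), and the condition says that `G(S + v) G(S - v)` does not
depend on `v ∈ (-S, S)`, for almost every `S > 0` (`ae_exists_const_of_ae_ae`). Hence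
`G(s + δ) G(t) = G(s) G(t + δ)`; integrating against a test function in `t` shows that a shift by
`δ` multiplies `G` by a smooth multiplicative function of `δ`, so `G` is an exponential
(`ae_eq_const_mul_exp_of_shift`), decaying because `F` is square integrable. The inverse Fourier
transform of the resulting Gaussian `F` is the Gaussian `f`.
-/

open scoped SchwartzMap ContDiff

/-! ### The Fourier transform on `L²` -/

section FourierLTwo

variable {V : Type*} [NormedAddCommGroup V] [InnerProductSpace ℝ V] [FiniteDimensional ℝ V]
  [MeasurableSpace V] [BorelSpace V]

theorem ae_eq_of_forall_integral_schwartz_mul_eq {u v : V → ℂ}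
    (hu : LocallyIntegrable u) (hv : LocallyIntegrable v)
    (hui : ∀ φ : 𝓢(V, ℂ), Integrable (fun x => φ x * u x))
    (hvi : ∀ φ : 𝓢(V, ℂ), Integrable (fun x => φ x * v x))
    (h : ∀ φ : 𝓢(V, ℂ), ∫ x, φ x * u x = ∫ x, φ x * v x) : u =ᵐ[volume] v := by
  have h0 : ∀ᵐ x, (u - v) x = 0 := by
    apply ae_eq_zero_of_integral_contDiff_smul_eq_zero (hu.sub hv)
    intro g g_smooth g_cpt
    have hg₁ : HasCompactSupport (Complex.ofRealCLM ∘ g) := g_cpt.comp_left rfl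
    have hg₂ : ContDiff ℝ ∞ (Complex.ofRealCLM ∘ g) := by fun_prop
    have := h (hg₁.toSchwartzMap hg₂)
    rw [← sub_eq_zero, ← integral_sub (hui _) (hvi _)] at this
    simpa [mul_sub] using this
  filter_upwards [h0] with x hx
  simpa [sub_eq_zero] using hx

theorem SchwartzMap.integrable_mul_memLp_two (φ : 𝓢(V, ℂ)) {u : V → ℂ} (hu : MemLp u 2) :
    Integrable (fun x => φ x * u x) :=
  (φ.memLp 2).integrable_mul hu

theorem SchwartzMap.integrable_mul_integrable (φ : 𝓢(V, ℂ)) {u : V → ℂ} (hu : Integrable u) :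
    Integrable (fun x => φ x * u x) := by
  obtain ⟨C, hC⟩ := φ.decay 0 0
  refine hu.bdd_mul (c := C) φ.continuous.aestronglyMeasurable (Filter.Eventually.of_forall ?_)
  intro x
  simpa using hC.2 x

theorem integral_schwartz_mul_fourier_Lp (f : Lp ℂ 2 (volume : Measure V)) (φ : 𝓢(V, ℂ)) :
    ∫ x, φ x * (𝓕 f : Lp ℂ 2 (volume : Measure V)) x = ∫ x, (𝓕 φ) x * f x := by
  have := congrArg (fun T => T φ) (Lp.fourier_toTemperedDistribution_eq f)
  simp only [TemperedDistribution.fourier_apply, Lp.toTemperedDistribution_apply, smul_eq_mul]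
    at this
  exact this.symm

theorem integral_schwartz_mul_fourier {g : V → ℂ} (hg : Integrable g) (φ : 𝓢(V, ℂ)) :
    ∫ x, φ x * (𝓕 g) x = ∫ x, (𝓕 φ) x * g x := by
  have h := VectorFourier.integral_fourierIntegral_smul_eq_flip (e := Real.fourierChar)
    (L := innerₗ V) (μ := volume) (ν := volume) (f := φ) (g := g)
    Real.continuous_fourierChar continuous_inner φ.integrable hg
  rw [flip_innerₗ] at h
  simp only [smul_eq_mul] at h
  rw [SchwartzMap.fourier_coe]
  exact h.symm

theorem continuous_fourier_of_integrable {g : V → ℂ} (hg : Integrable g) : Continuous (𝓕 g) :=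
  VectorFourier.fourierIntegral_continuous Real.continuous_fourierChar continuous_inner hg

/-- On `L¹ ∩ L²` the Plancherel transform is given by the Fourier integral. -/
theorem fourier_Lp_ae_eq_of_integrable (f : Lp ℂ 2 (volume : Measure V)) {g : V → ℂ}
    (hg : Integrable g) (hfg : f =ᵐ[volume] g) :
    (𝓕 f : Lp ℂ 2 (volume : Measure V)) =ᵐ[volume] 𝓕 g := by
  have hc := continuous_fourier_of_integrable hg
  have hbd : ∀ x, ‖𝓕 g x‖ ≤ ∫ v, ‖g v‖ := fun x =>
    VectorFourier.norm_fourierIntegral_le_integral_norm _ _ _ _ _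
  refine ae_eq_of_forall_integral_schwartz_mul_eq
    ((Lp.memLp _).locallyIntegrable (by norm_num)) hc.locallyIntegrable
    (fun φ => φ.integrable_mul_memLp_two (Lp.memLp _))
    (fun φ => φ.integrable.mul_bdd (c := ∫ v, ‖g v‖) hc.aestronglyMeasurable
      (Filter.Eventually.of_forall hbd)) fun φ => ?_
  rw [integral_schwartz_mul_fourier_Lp, integral_schwartz_mul_fourier hg]
  refine integral_congr_ae ?_
  filter_upwards [hfg] with x hx
  rw [hx]

theorem eLpNorm_fourier_Lp (f : Lp ℂ 2 (volume : Measure V)) :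
    eLpNorm (𝓕 f : Lp ℂ 2 (volume : Measure V)) 2 volume = eLpNorm f 2 volume := by
  have := Lp.norm_fourier_eq f
  rw [Lp.norm_def, Lp.norm_def] at this
  rwa [ENNReal.toReal_eq_toReal_iff' (Lp.eLpNorm_ne_top _) (Lp.eLpNorm_ne_top _)] at this

/-- Plancherel for integrable functions, as an identity in `[0, ∞]`: if one of the two sides is
finite, so is the other. -/
theorem eLpNorm_two_fourier_of_integrable {g : V → ℂ} (hg : Integrable g) :
    eLpNorm (𝓕 g) 2 volume = eLpNorm g 2 volume := by
  by_cases h2 : MemLp g 2 volume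
  · have h := fourier_Lp_ae_eq_of_integrable (h2.toLp g) hg h2.coeFn_toLp
    rw [← eLpNorm_congr_ae h, eLpNorm_fourier_Lp, eLpNorm_congr_ae h2.coeFn_toLp]
  by_cases h3 : MemLp (𝓕 g) 2 volume
  · exfalso
    apply h2
    -- The `L²` function with Fourier transform `𝓕 g` agrees with `g` as a tempered distribution.
    set k := 𝓕⁻ (h3.toLp (𝓕 g)) with hk
    have hkf : 𝓕 k = h3.toLp (𝓕 g) := by rw [hk, fourier_fourierInv_eq]
    have hkg : k =ᵐ[volume] g := by
      refine ae_eq_of_forall_integral_schwartz_mul_eq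
        ((Lp.memLp _).locallyIntegrable (by norm_num)) hg.locallyIntegrable
        (fun φ => φ.integrable_mul_memLp_two (Lp.memLp _))
        (fun φ => φ.integrable_mul_integrable hg) fun φ => ?_
      have hφ : 𝓕 (𝓕⁻ φ) = φ := fourier_fourierInv_eq φ
      rw [← hφ, ← integral_schwartz_mul_fourier_Lp, ← integral_schwartz_mul_fourier hg, hkf]
      refine integral_congr_ae ?_
      filter_upwards [h3.coeFn_toLp] with x hx
      rw [hx]
    exact (memLp_congr_ae hkg).1 (Lp.memLp k)
  · have a : eLpNorm g 2 volume = (⊤ : ℝ≥0∞) := by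
      by_contra hne
      exact h2 ⟨hg.aestronglyMeasurable, lt_top_iff_ne_top.2 hne⟩
    have b : eLpNorm (𝓕 g) 2 volume = (⊤ : ℝ≥0∞) := by
      by_contra hne
      exact h3 ⟨(continuous_fourier_of_integrable hg).aestronglyMeasurable,
        lt_top_iff_ne_top.2 hne⟩
    rw [a, b]

theorem fourier_Lp_comp_linearIsometryEquiv (R : V ≃ₗᵢ[ℝ] V)
    (f g : Lp ℂ 2 (volume : Measure V)) (hg : g =ᵐ[volume] fun x => f (R x)) :
    (𝓕 g : Lp ℂ 2 (volume : Measure V)) =ᵐ[volume]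
      fun x => (𝓕 f : Lp ℂ 2 (volume : Measure V)) (R x) := by
  have hR := R.measurePreserving
  have hRm : MemLp (fun x => (𝓕 f : Lp ℂ 2 (volume : Measure V)) (R x)) 2 volume :=
    (Lp.memLp (𝓕 f : Lp ℂ 2 (volume : Measure V))).comp_measurePreserving hR
  refine ae_eq_of_forall_integral_schwartz_mul_eq
    ((Lp.memLp _).locallyIntegrable (by norm_num))
    (hRm.locallyIntegrable (by norm_num))
    (fun φ => φ.integrable_mul_memLp_two (Lp.memLp _))
    (fun φ => φ.integrable_mul_memLp_two hRm) fun φ => ?_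
  let ψ : 𝓢(V, ℂ) :=
    SchwartzMap.compCLMOfContinuousLinearEquiv ℂ R.symm.toContinuousLinearEquiv φ
  have hψ : ∀ x, ψ x = φ (R.symm x) := fun x => rfl
  have hψf : ∀ x, (𝓕 ψ) x = (𝓕 φ) (R.symm x) := by
    intro x
    rw [SchwartzMap.fourier_coe, SchwartzMap.fourier_coe,
      ← Real.fourier_comp_linearIsometry R.symm φ x]
    rfl
  calc ∫ x, φ x * (𝓕 g : Lp ℂ 2 (volume : Measure V)) x
      = ∫ x, (𝓕 φ) x * g x := integral_schwartz_mul_fourier_Lp g φ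
    _ = ∫ x, (𝓕 φ) x * f (R x) := by
        refine integral_congr_ae ?_
        filter_upwards [hg] with x hx
        rw [hx]
    _ = ∫ x, (𝓕 ψ) (R x) * f (R x) := by simp [hψf]
    _ = ∫ x, (𝓕 ψ) x * f x :=
        hR.integral_comp R.toHomeomorph.measurableEmbedding (fun x => (𝓕 ψ) x * f x)
    _ = ∫ x, ψ x * (𝓕 f : Lp ℂ 2 (volume : Measure V)) x :=
        (integral_schwartz_mul_fourier_Lp f ψ).symm
    _ = ∫ x, ψ (R x) * (𝓕 f : Lp ℂ 2 (volume : Measure V)) (R x) :=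
        (hR.integral_comp R.toHomeomorph.measurableEmbedding
          (fun x => ψ x * (𝓕 f : Lp ℂ 2 (volume : Measure V)) x)).symm
    _ = _ := by simp [hψ]

/-- The case of one Schwartz factor of `fourier_mul_Lp_eq_integral`, from which the general case
follows by density. -/
theorem fourier_mul_schwartz_eq_integral (u : Lp ℂ 2 (volume : Measure V)) (v : 𝓢(V, ℂ)) (p : V) :
    𝓕 (fun x => u x * v x) p
      = ∫ η, (𝓕 u : Lp ℂ 2 (volume : Measure V)) η * (𝓕 v) (p - η) := by
  -- The translated reflection `b η = 𝓕 v (p - η)` has Fourier transform `e^{-2πi x·p} v(x)`.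
  let b : 𝓢(V, ℂ) := SchwartzMap.compCLMOfContinuousLinearEquiv ℂ
    (ContinuousLinearEquiv.neg ℝ) (SchwartzMap.compSubConstCLM ℂ (-p) (𝓕 v))
  have hb : ∀ η, b η = (𝓕 v) (p - η) := fun η => by
    change (SchwartzMap.compSubConstCLM ℂ (-p) (𝓕 v)) (-η) = _
    rw [SchwartzMap.compSubConstCLM_apply]
    congr 1
    abel
  have hbf : ∀ x, (𝓕 b) x = Real.fourierChar (-(inner ℝ x p)) • v x := by
    intro x
    have hinv : 𝓕⁻ (𝓕 v) x = v x := by rw [fourierInv_fourier_eq]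
    rw [SchwartzMap.fourier_coe, Real.fourier_eq, ← hinv, SchwartzMap.fourierInv_coe,
      Real.fourierInv_eq]
    simp only [hb]
    rw [← integral_sub_left_eq_self _ volume p, Circle.smul_def, ← integral_smul]
    refine integral_congr_ae (Filter.Eventually.of_forall fun η => ?_)
    simp only [sub_sub_cancel, ← Circle.smul_def, smul_smul]
    rw [← AddChar.map_add_eq_mul, inner_sub_left, real_inner_comm p x]
    congr 2
    ring
  have h := integral_schwartz_mul_fourier_Lp u b
  rw [Real.fourier_eq]
  calc ∫ x, Real.fourierChar (-(inner ℝ x p)) • (u x * v x) = ∫ x, (𝓕 b) x * u x := by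
        refine integral_congr_ae (Filter.Eventually.of_forall fun x => ?_)
        simp only [hbf, Circle.smul_def, smul_eq_mul]
        ring
    _ = _ := h.symm
    _ = _ := by
        refine integral_congr_ae (Filter.Eventually.of_forall fun x => ?_)
        simp only [hb]
        ring

/-- The Fourier transform of a product of two `L²` functions is the convolution of their Fourier
transforms, at every point. -/
theorem fourier_mul_Lp_eq_integral (u v : Lp ℂ 2 (volume : Measure V)) (p : V) :
    𝓕 (fun x => u x * v x) p
      = ∫ η, (𝓕 u : Lp ℂ 2 (volume : Measure V)) η
          * (𝓕 v : Lp ℂ 2 (volume : Measure V)) (p - η) := by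
  have hm1 : MemLp (fun x => starRingEnd ℂ (Real.fourierChar (-(inner ℝ x p)) • u x)) 2 volume := by
    refine (Lp.memLp u).of_le ?_ (Filter.Eventually.of_forall fun x => ?_)
    · refine (Complex.continuous_conj.comp_aestronglyMeasurable ?_)
      have hc : Continuous fun x : V => -(inner ℝ x p) := by fun_prop
      exact (continuous_subtype_val.comp
        (Real.continuous_fourierChar.comp hc)).aestronglyMeasurable.mul
        (Lp.aestronglyMeasurable u)
    · simp
  have hsub : MeasurePreserving (fun η : V => p - η) volume volume :=
    Measure.measurePreserving_sub_left volume p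
  have hm2 : MemLp (fun η => starRingEnd ℂ ((𝓕 u : Lp ℂ 2 (volume : Measure V)) (p - η)))
      2 volume := by
    refine ((Lp.memLp (𝓕 u : Lp ℂ 2 (volume : Measure V))).comp_measurePreserving hsub).of_le ?_
      (Filter.Eventually.of_forall fun x => ?_)
    · exact Complex.continuous_conj.comp_aestronglyMeasurable
        ((Lp.memLp (𝓕 u : Lp ℂ 2 (volume : Measure V))).comp_measurePreserving hsub).1
    · simp
  have key : ∀ w : Lp ℂ 2 (volume : Measure V),
      inner ℂ (hm1.toLp _) w = inner ℂ (hm2.toLp _) (𝓕 w) := by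
    intro w
    refine DenseRange.induction_on
      (p := fun w : Lp ℂ 2 (volume : Measure V) =>
        inner ℂ (hm1.toLp _) w = inner ℂ (hm2.toLp _) (𝓕 w))
      (SchwartzMap.denseRange_toLpCLM (p := 2) (μ := volume) ENNReal.ofNat_ne_top) w ?_ ?_
    · exact isClosed_eq (by fun_prop)
        (continuous_const.inner (Lp.fourierTransformₗᵢ V ℂ).continuous)
    · intro φ
      rw [SchwartzMap.toLpCLM_apply, SchwartzMap.toLp_fourier_eq, L2.inner_def, L2.inner_def]
      have h := fourier_mul_schwartz_eq_integral u φ p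
      rw [Real.fourier_eq] at h
      trans ∫ x, Real.fourierChar (-(inner ℝ x p)) • (u x * φ x)
      · refine integral_congr_ae ?_
        filter_upwards [hm1.coeFn_toLp, φ.coeFn_toLp 2 volume] with x h1 h2
        rw [h1, h2]
        simp [Circle.smul_def]
        ring
      · rw [h, ← integral_sub_left_eq_self _ volume p]
        refine integral_congr_ae ?_
        filter_upwards [hm2.coeFn_toLp, (𝓕 φ).coeFn_toLp 2 volume] with x h1 h2
        rw [h1, h2]
        simp
        ring
  have h := key v
  rw [L2.inner_def, L2.inner_def] at h
  rw [Real.fourier_eq]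
  trans ∫ x, inner ℂ ((hm1.toLp _) x) (v x)
  · refine integral_congr_ae ?_
    filter_upwards [hm1.coeFn_toLp] with x h1
    rw [h1]
    simp [Circle.smul_def]
    ring
  · rw [h, ← integral_sub_left_eq_self _ volume p]
    refine integral_congr_ae ?_
    filter_upwards [hsub.quasiMeasurePreserving.ae_eq_comp hm2.coeFn_toLp] with x h1
    simp only [Function.comp_apply] at h1
    rw [h1]
    simp
    ring

end FourierLTwo

/-! ### Polar coordinates in the squared radius, and variance -/

/-- The point of the plane at angle `z.2` whose squared distance to the origin is `z.1`. -/
noncomputable def sqPolar (z : ℝ × ℝ) : EuclideanSpace ℝ (Fin 2) :=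
  !₂[√z.1 * Real.cos z.2, √z.1 * Real.sin z.2]

/-- The measure `½ ds dθ` on `(0, ∞) × (-π, π)`, which `sqPolar` pushes to Lebesgue measure. -/
noncomputable def sqPolarMeasure : Measure (ℝ × ℝ) :=
  (2⁻¹ : ℝ≥0∞) • (volume.restrict (Set.Ioi 0)).prod (volume.restrict (Set.Ioo (-Real.pi) Real.pi))

theorem continuous_sqPolar : Continuous sqPolar := by
  unfold sqPolar
  refine (PiLp.continuous_toLp 2 _).comp (continuous_pi fun i => ?_)
  fin_cases i <;> simp <;> fun_prop

theorem norm_sq_sqPolar {s : ℝ} (hs : 0 ≤ s) (θ : ℝ) : ‖sqPolar (s, θ)‖ ^ 2 = s := by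
  rw [EuclideanSpace.norm_sq_eq]
  simp only [sqPolar, Fin.sum_univ_two, Real.norm_eq_abs, sq_abs]
  simp only [Matrix.cons_val_zero, Matrix.cons_val_one]
  rw [mul_pow, mul_pow, Real.sq_sqrt hs, ← mul_add, Real.cos_sq_add_sin_sq, mul_one]

theorem lintegral_Ioi_comp_sq (Φ : ℝ → ℝ≥0∞) :
    ∫⁻ s in Set.Ioi (0 : ℝ), Φ s = ∫⁻ r in Set.Ioi (0 : ℝ), ENNReal.ofReal (2 * r) * Φ (r ^ 2) := by
  have himg : (fun r : ℝ => r ^ 2) '' Set.Ioi 0 = Set.Ioi 0 := by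
    ext s
    constructor
    · rintro ⟨r, hr, rfl⟩
      exact Set.mem_Ioi.2 (pow_pos (Set.mem_Ioi.1 hr) 2)
    · intro hs
      exact ⟨√s, Real.sqrt_pos.2 hs, Real.sq_sqrt (le_of_lt hs)⟩
  have h := lintegral_image_eq_lintegral_abs_deriv_mul (s := Set.Ioi (0 : ℝ))
    (f := fun r => r ^ 2) (f' := fun r => 2 * r) measurableSet_Ioi
    (fun r _ => by simpa using (hasDerivAt_pow 2 r).hasDerivWithinAt)
    (fun a ha b hb hab => (sq_eq_sq₀ (le_of_lt ha) (le_of_lt hb)).1 hab) Φ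
  rw [himg] at h
  rw [h]
  refine setLIntegral_congr_fun measurableSet_Ioi fun r hr => ?_
  have : (0 : ℝ) < 2 * r := mul_pos two_pos hr
  simp only [abs_of_pos this]

theorem measurePreserving_sqPolar : MeasurePreserving sqPolar sqPolarMeasure volume := by
  refine ⟨continuous_sqPolar.measurable, Measure.ext_of_lintegral _ fun f hf => ?_⟩
  have hiso := Complex.orthonormalBasisOneI.repr.measurePreserving
  have hfm : Measurable fun z => f (sqPolar z) := hf.comp continuous_sqPolar.measurable
  rw [lintegral_map hf continuous_sqPolar.measurable, sqPolarMeasure, lintegral_smul_measure,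
    ← hiso.lintegral_comp hf, ← Complex.lintegral_comp_polarCoord_symm, polarCoord_target,
    Measure.volume_eq_prod, ← Measure.prod_restrict,
    lintegral_prod _ hfm.aemeasurable]
  rw [lintegral_prod _ ?_, lintegral_Ioi_comp_sq, smul_eq_mul, ← lintegral_const_mul']
  · refine setLIntegral_congr_fun measurableSet_Ioi fun r hr => ?_
    simp only [smul_eq_mul]
    rw [← mul_assoc, lintegral_const_mul' _ _ ENNReal.ofReal_ne_top]
    congr 1
    · rw [ENNReal.ofReal_mul zero_le_two, ← mul_assoc, ENNReal.ofReal_ofNat,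
        ENNReal.inv_mul_cancel two_ne_zero ENNReal.ofNat_ne_top, one_mul]
    · refine lintegral_congr fun θ => ?_
      congr 1
      have hr0 : (0 : ℝ) ≤ r := le_of_lt hr
      ext i
      fin_cases i <;>
        simp [sqPolar, Complex.orthonormalBasisOneI_repr_apply, Complex.polarCoord_symm_apply,
          Real.sqrt_sq hr0, Complex.cos_ofReal_re, Complex.sin_ofReal_re]
  · exact ENNReal.inv_ne_top.2 two_ne_zero
  · have hc : Measurable fun z : ℝ × ℝ => Complex.polarCoord.symm z := by
      simp only [Complex.polarCoord_symm_apply]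
      fun_prop
    have h1 : Measurable fun z : ℝ × ℝ => ENNReal.ofReal z.1 := by fun_prop
    exact (h1.smul (hf.comp (hiso.measurable.comp hc))).aemeasurable

theorem ae_sqPolarMeasure_iff {P : ℝ × ℝ → Prop} :
    (∀ᵐ z ∂sqPolarMeasure, P z) ↔
      ∀ᵐ z ∂(volume.restrict (Set.Ioi 0)).prod (volume.restrict (Set.Ioo (-Real.pi) Real.pi)),
        P z := by
  rw [sqPolarMeasure, Measure.ae_ennreal_smul_measure_eq (by simp)]

/-- In centre-of-mass coordinates `a = p/2 + q`, `b = p/2 - q`, the Jacobian is `1`. -/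
theorem measurePreserving_halfSum_diff {V : Type*} [NormedAddCommGroup V] [NormedSpace ℝ V]
    [FiniteDimensional ℝ V] [MeasurableSpace V] [BorelSpace V] (μ : Measure V)
    [μ.IsAddHaarMeasure] :
    MeasurePreserving (fun z : V × V => ((2⁻¹ : ℝ) • z.1 + z.2, (2⁻¹ : ℝ) • z.1 - z.2))
      (μ.prod μ) (μ.prod μ) := by
  have h1 : MeasurePreserving (fun z : V × V => (z.1, (2⁻¹ : ℝ) • z.1 + z.2))
      (μ.prod μ) (μ.prod μ) :=
    (MeasurePreserving.id μ).skew_product (g := fun p q => (2⁻¹ : ℝ) • p + q)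
      (by fun_prop) (Filter.Eventually.of_forall fun p => map_add_left_eq_self μ _)
  have h2 := (measurePreserving_prod_neg_add_swap μ μ).comp h1
  convert h2 using 1
  ext1 z
  simp only [Function.comp_apply, Prod.mk.injEq, true_and]
  have : z.1 = (2⁻¹ : ℝ) • z.1 + (2⁻¹ : ℝ) • z.1 := by
    rw [← add_smul]; norm_num
  nth_rewrite 3 [this]
  abel

/-- The variance identity on a finite measure space, valid in `[0, ∞]`. -/
theorem lintegral_enorm_sq_eq_variance {α : Type*} [MeasurableSpace α] (μ : Measure α)
    [IsFiniteMeasure μ] [NeZero μ] {h : α → ℂ} (hh : Integrable h μ) :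
    ∫⁻ x, ‖h x‖ₑ ^ 2 ∂μ = (μ Set.univ)⁻¹ * ‖∫ x, h x ∂μ‖ₑ ^ 2
      + ∫⁻ x, ‖h x - ⨍ y, h y ∂μ‖ₑ ^ 2 ∂μ := by
  set c : ℂ := ⨍ y, h y ∂μ with hc
  have hM : (0 : ℝ) < μ.real Set.univ := by
    rw [measureReal_def]
    exact ENNReal.toReal_pos (NeZero.ne _) (measure_ne_top _ _)
  have hint : ∫ x, h x ∂μ = (μ.real Set.univ : ℂ) * c := by
    rw [hc, average_eq, Complex.real_smul, ← mul_assoc, ← Complex.ofReal_mul,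
      mul_inv_cancel₀ hM.ne', Complex.ofReal_one, one_mul]
  have henorm : ∀ z : ℂ, ‖z‖ₑ ^ 2 = ENNReal.ofReal (‖z‖ ^ 2) := fun z => by
    rw [ENNReal.ofReal_pow (norm_nonneg _), ofReal_norm]
  have hmem : ∀ {g : α → ℂ}, MemLp g 2 μ → ∫⁻ x, ‖g x‖ₑ ^ 2 ∂μ
      = ENNReal.ofReal (∫ x, ‖g x‖ ^ 2 ∂μ) := fun {g} hg => by
    rw [ofReal_integral_eq_lintegral_ofReal hg.integrable_norm_pow'
      (Filter.Eventually.of_forall fun x => by positivity)]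
    simp only [henorm]
  have hinf : ∀ {g : α → ℂ}, AEStronglyMeasurable g μ → ¬ MemLp g 2 μ →
      ∫⁻ x, ‖g x‖ₑ ^ 2 ∂μ = ⊤ := fun {g} hgm hg => by
    by_contra hne
    refine hg ⟨hgm, ?_⟩
    rw [eLpNorm_lt_top_iff_lintegral_rpow_enorm_lt_top two_ne_zero ENNReal.ofNat_ne_top]
    simpa using lt_top_iff_ne_top.2 hne
  by_cases h2 : MemLp h 2 μ
  · have h2c : MemLp (fun x => h x - c) 2 μ := h2.sub (memLp_const c)
    have hreal : ∫ x, ‖h x‖ ^ 2 ∂μ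
        = μ.real Set.univ * ‖c‖ ^ 2 + ∫ x, ‖h x - c‖ ^ 2 ∂μ := by
      have hexp : ∀ x, ‖h x‖ ^ 2 = ‖h x - c‖ ^ 2 + ‖c‖ ^ 2
          + 2 * (starRingEnd ℂ c * (h x - c)).re := fun x => by
        rw [← Complex.normSq_eq_norm_sq, ← Complex.normSq_eq_norm_sq, ← Complex.normSq_eq_norm_sq]
        simp only [Complex.normSq_apply, Complex.mul_re, Complex.sub_re, Complex.sub_im,
          Complex.conj_re, Complex.conj_im]
        ring
      have hz : ∫ x, (starRingEnd ℂ c * (h x - c)) ∂μ = 0 := by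
        rw [integral_const_mul, integral_sub hh (integrable_const c), hint, integral_const,
          Complex.real_smul, sub_self, mul_zero]
      have hI : Integrable (fun x => starRingEnd ℂ c * (h x - c)) μ :=
        (hh.sub (integrable_const c)).const_mul _
      have hre : ∫ x, (starRingEnd ℂ c * (h x - c)).re ∂μ = 0 := by
        have := integral_re hI
        simp only [RCLike.re_to_complex] at this
        rw [this, hz, Complex.zero_re]
      have hI' : Integrable (fun x => 2 * (starRingEnd ℂ c * (h x - c)).re) μ :=
        hI.re.const_mul 2
      have hJ : Integrable (fun x => ‖h x - c‖ ^ 2) μ := h2c.integrable_norm_pow'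
      have hJc : Integrable (fun x => ‖h x - c‖ ^ 2 + ‖c‖ ^ 2) μ := hJ.add (integrable_const _)
      simp only [hexp]
      rw [integral_add hJc hI', integral_add hJ (integrable_const _),
        integral_const_mul, hre, integral_const, smul_eq_mul]
      ring
    rw [hmem h2, hmem h2c, hreal, hint, henorm,
      ENNReal.ofReal_add (by positivity) (integral_nonneg fun x => by positivity)]
    congr 1
    rw [← ofReal_measureReal (μ := μ) (s := Set.univ), ← ENNReal.ofReal_inv_of_pos hM,
      ← ENNReal.ofReal_mul (by positivity)]
    congr 1
    rw [norm_mul, Complex.norm_real, Real.norm_of_nonneg hM.le]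
    field_simp
  · have h2c : ¬ MemLp (fun x => h x - c) 2 μ := fun hm => h2 (by
      simpa [Pi.add_def] using hm.add (memLp_const c))
    have hsm : AEStronglyMeasurable (fun x => h x - c) μ :=
      (hh.sub (integrable_const c)).aestronglyMeasurable
    rw [hinf hh.aestronglyMeasurable h2,
      hinf hsm h2c, add_top]

/-! ### Plancherel at fixed time and Cauchy-Schwarz on circles -/

theorem eLpNorm_two_sq {α : Type*} [MeasurableSpace α] (μ : Measure α) (g : α → ℂ) :
    eLpNorm g 2 μ ^ 2 = ∫⁻ x, ‖g x‖ₑ ^ 2 ∂μ := by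
  have h := eLpNorm_nnreal_pow_eq_lintegral (f := g) (μ := μ) (p := 2) two_ne_zero
  simpa using h

theorem eLpNorm_four_pow {α : Type*} [MeasurableSpace α] (μ : Measure α) (g : α → ℂ) :
    eLpNorm g 4 μ ^ 4 = ∫⁻ x, ‖g x‖ₑ ^ 4 ∂μ := by
  have h := eLpNorm_nnreal_pow_eq_lintegral (f := g) (μ := μ) (p := 4) four_ne_zero
  simpa using h

/-- The product `F a * F b` in centre-of-mass coordinates `a = p/2 + q`, `b = p/2 - q`. -/
noncomputable def pairProduct {V : Type*} [AddCommGroup V] [Module ℝ V] (F : V → ℂ) (p q : V) : ℂ :=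
  F ((2⁻¹ : ℝ) • p + q) * F ((2⁻¹ : ℝ) • p - q)

section Slice

variable {d : ℕ}

theorem fourier_schrodingerPropagator (t : ℝ)
    (f : Lp ℂ 2 (volume : Measure (EuclideanSpace ℝ (Fin d)))) :
    (𝓕 (schrodingerPropagator t f) : Lp ℂ 2 (volume : Measure (EuclideanSpace ℝ (Fin d))))
      =ᵐ[volume] fun ξ => schrodingerSymbol d t ξ *
        (𝓕 f : Lp ℂ 2 (volume : Measure (EuclideanSpace ℝ (Fin d)))) ξ := by
  rw [schrodingerPropagator, fourier_fourierInv_eq]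
  exact MemLp.coeFn_toLp _

/-- By the parallelogram law the phases combine to a function of `p` and a function of `‖q‖`. -/
theorem pairProduct_schrodingerSymbol (t : ℝ) (p q : EuclideanSpace ℝ (Fin d)) :
    pairProduct (schrodingerSymbol d t) p q
      = Complex.exp (((-(2 * Real.pi ^ 2 * t * ‖p‖ ^ 2) : ℝ) : ℂ) * Complex.I) *
        Complex.exp (((-(8 * Real.pi ^ 2 * t * ‖q‖ ^ 2) : ℝ) : ℂ) * Complex.I) := by
  have h := parallelogram_law_with_norm ℝ ((2⁻¹ : ℝ) • p) q
  rw [norm_smul] at h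
  have h' : ‖(2⁻¹ : ℝ) • p + q‖ ^ 2 + ‖(2⁻¹ : ℝ) • p - q‖ ^ 2 = 2⁻¹ * ‖p‖ ^ 2 + 2 * ‖q‖ ^ 2 := by
    norm_num at h
    nlinarith
  rw [pairProduct, schrodingerSymbol, schrodingerSymbol, ← Complex.exp_add, ← Complex.exp_add]
  congr 1
  have h'' := congrArg (fun x : ℝ => (x : ℂ)) h'
  push_cast at h'' ⊢
  linear_combination (-4 * (Real.pi : ℂ) ^ 2 * Complex.I * t) * h''

/-- Plancherel in `x` at a fixed time: the `L⁴` norm of the solution is the `L²` norm of the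
self-convolution of its Fourier transform, whose phase in `p` has been dropped. -/
theorem lintegral_schrodingerPropagator_pow_four (t : ℝ)
    (f : Lp ℂ 2 (volume : Measure (EuclideanSpace ℝ (Fin d)))) :
    ∫⁻ x, ‖schrodingerPropagator t f x‖ₑ ^ 4
      = ∫⁻ p, ‖∫ q, pairProduct (𝓕 f : Lp ℂ 2 (volume : Measure (EuclideanSpace ℝ (Fin d)))) p q *
          Complex.exp (((-(8 * Real.pi ^ 2 * t * ‖q‖ ^ 2) : ℝ) : ℂ) * Complex.I)‖ₑ ^ 2 := by
  set u := schrodingerPropagator t f with hu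
  have hint : Integrable (fun x => u x * u x) := (Lp.memLp u).integrable_mul (Lp.memLp u)
  have h1 := congrArg (· ^ 2) (eLpNorm_two_fourier_of_integrable hint)
  simp only [eLpNorm_two_sq] at h1
  have h2 : ∀ x, ‖u x‖ₑ ^ 4 = ‖u x * u x‖ₑ ^ 2 := fun x => by
    rw [enorm_mul]; ring
  simp only [h2]
  rw [← h1]
  refine lintegral_congr fun p => ?_
  rw [fourier_mul_Lp_eq_integral, ← integral_add_left_eq_self _ ((2⁻¹ : ℝ) • p)]
  have hF := fourier_schrodingerPropagator t f
  have hq1 := (measurePreserving_add_left volume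
    ((2⁻¹ : ℝ) • p)).quasiMeasurePreserving.ae hF
  have hq2 := (Measure.measurePreserving_sub_left volume
    ((2⁻¹ : ℝ) • p)).quasiMeasurePreserving.ae hF
  have hcongr : ∫ q, (𝓕 u : Lp ℂ 2 (volume : Measure (EuclideanSpace ℝ (Fin d))))
        ((2⁻¹ : ℝ) • p + q) *
        (𝓕 u : Lp ℂ 2 (volume : Measure (EuclideanSpace ℝ (Fin d)))) (p - ((2⁻¹ : ℝ) • p + q))
      = Complex.exp (((-(2 * Real.pi ^ 2 * t * ‖p‖ ^ 2) : ℝ) : ℂ) * Complex.I) *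
        ∫ q, pairProduct (𝓕 f : Lp ℂ 2 (volume : Measure (EuclideanSpace ℝ (Fin d)))) p q *
          Complex.exp (((-(8 * Real.pi ^ 2 * t * ‖q‖ ^ 2) : ℝ) : ℂ) * Complex.I) := by
    rw [← integral_const_mul]
    refine integral_congr_ae ?_
    filter_upwards [hq1, hq2] with q h3 h4
    have h5 : p - ((2⁻¹ : ℝ) • p + q) = (2⁻¹ : ℝ) • p - q := by
      have : p = (2⁻¹ : ℝ) • p + (2⁻¹ : ℝ) • p := by
        rw [← add_smul]; norm_num
      nth_rewrite 1 [this]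
      abel
    have h6 := pairProduct_schrodingerSymbol t p q
    rw [h5, hu, h3, h4]
    rw [pairProduct] at h6 ⊢
    linear_combination ((𝓕 f : Lp ℂ 2 (volume : Measure (EuclideanSpace ℝ (Fin d))))
      ((2⁻¹ : ℝ) • p + q) * (𝓕 f : Lp ℂ 2 (volume : Measure (EuclideanSpace ℝ (Fin d))))
      ((2⁻¹ : ℝ) • p - q)) * h6
  rw [hcongr, enorm_mul, ← ofReal_norm, Complex.norm_exp_ofReal_mul_I, ENNReal.ofReal_one, one_mul]

end Slice

/-- Lebesgue measure on the interval of angles `(-π, π)`. -/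
noncomputable abbrev angleMeasure : Measure ℝ := volume.restrict (Set.Ioo (-Real.pi) Real.pi)

instance neZero_angleMeasure : NeZero angleMeasure := ⟨by
  rw [Ne, Measure.restrict_eq_zero, Real.volume_Ioo]
  simp [Real.pi_pos]⟩

/-- The failure of a function on the plane to be constant on circles about the origin: half the
integral over `s > 0` of the squared deviation, on the circle of squared radius `s`, from the mean
over that circle. It vanishes for radial functions. -/
noncomputable def circularDefect (h : EuclideanSpace ℝ (Fin 2) → ℂ) : ℝ≥0∞ :=
  2⁻¹ * ∫⁻ s in Set.Ioi (0 : ℝ), ∫⁻ θ, ‖h (sqPolar (s, θ))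
    - ⨍ φ, h (sqPolar (s, φ)) ∂angleMeasure‖ₑ ^ 2 ∂angleMeasure

theorem integrable_comp_sqPolar {h : EuclideanSpace ℝ (Fin 2) → ℂ} (hi : Integrable h) :
    Integrable (fun z => h (sqPolar z)) ((volume.restrict (Set.Ioi 0)).prod angleMeasure) := by
  have h1 : Integrable (fun z => h (sqPolar z)) sqPolarMeasure :=
    (measurePreserving_sqPolar.integrable_comp hi.aestronglyMeasurable).2 hi
  rwa [sqPolarMeasure, integrable_smul_measure (by simp) (by simp)] at h1

theorem integral_eq_sqPolar {h : EuclideanSpace ℝ (Fin 2) → ℂ} (hi : Integrable h) :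
    ∫ q, h q = ∫ s in Set.Ioi (0 : ℝ), 2⁻¹ * ∫ θ, h (sqPolar (s, θ)) ∂angleMeasure := by
  rw [← measurePreserving_sqPolar.map_eq, integral_map continuous_sqPolar.aemeasurable, sqPolarMeasure,
    integral_smul_measure, integral_prod _ (integrable_comp_sqPolar hi), integral_const_mul]
  · simp
  · rw [measurePreserving_sqPolar.map_eq]
    exact hi.aestronglyMeasurable

theorem lintegral_eq_sqPolar {h : EuclideanSpace ℝ (Fin 2) → ℝ≥0∞} (hm : AEMeasurable h) :
    ∫⁻ q, h q = 2⁻¹ * ∫⁻ s in Set.Ioi (0 : ℝ), ∫⁻ θ, h (sqPolar (s, θ)) ∂angleMeasure := by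
  have hq := hm.comp_quasiMeasurePreserving measurePreserving_sqPolar.quasiMeasurePreserving
  have hq' : AEMeasurable (fun z => h (sqPolar z))
      ((volume.restrict (Set.Ioi 0)).prod angleMeasure) := by
    rwa [sqPolarMeasure, aemeasurable_smul_measure_iff] at hq
    simp
  rw [← measurePreserving_sqPolar.map_eq, lintegral_map' , sqPolarMeasure,
    lintegral_smul_measure, lintegral_prod _ hq', smul_eq_mul]
  · rwa [measurePreserving_sqPolar.map_eq]
  · exact continuous_sqPolar.aemeasurable

theorem lintegral_comp_mul_left_real (φ : ℝ → ℝ≥0∞) (hφ : Measurable φ) {a : ℝ} (ha : 0 < a) :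
    ∫⁻ t, φ (a * t) = ENNReal.ofReal a⁻¹ * ∫⁻ t, φ t := by
  have h := lintegral_map (μ := volume) hφ (measurable_const_mul a)
  rw [Real.map_volume_mul_left ha.ne', lintegral_smul_measure, abs_of_pos (inv_pos.2 ha)] at h
  exact h.symm

/-- One-dimensional Plancherel in the variable dual to `‖q‖²`. -/
theorem lintegral_integral_mul_exp_norm_sq {h : EuclideanSpace ℝ (Fin 2) → ℂ} (hi : Integrable h) :
    ∫⁻ t : ℝ, ‖∫ q, h q *
        Complex.exp (((-(8 * Real.pi ^ 2 * t * ‖q‖ ^ 2) : ℝ) : ℂ) * Complex.I)‖ₑ ^ 2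
      = ENNReal.ofReal (4 * Real.pi)⁻¹ *
        ∫⁻ s in Set.Ioi (0 : ℝ), ‖2⁻¹ * ∫ θ, h (sqPolar (s, θ)) ∂angleMeasure‖ₑ ^ 2 := by
  set g : ℝ → ℂ := (Set.Ioi (0 : ℝ)).indicator
    fun s => 2⁻¹ * ∫ θ, h (sqPolar (s, θ)) ∂angleMeasure with hg
  have hgi : Integrable g := by
    rw [hg, integrable_indicator_iff measurableSet_Ioi]
    exact ((integrable_comp_sqPolar hi).integral_prod_left).const_mul _
  have hft : ∀ t : ℝ, ∫ q, h q *
      Complex.exp (((-(8 * Real.pi ^ 2 * t * ‖q‖ ^ 2) : ℝ) : ℂ) * Complex.I)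
        = 𝓕 g (4 * Real.pi * t) := fun t => by
    rw [integral_eq_sqPolar, Real.fourier_real_eq_integral_exp_smul, hg]
    · rw [← integral_indicator measurableSet_Ioi]
      refine integral_congr_ae (Filter.Eventually.of_forall fun s => ?_)
      by_cases hs : s ∈ Set.Ioi (0 : ℝ)
      · simp only [Set.indicator_of_mem hs, norm_sq_sqPolar (le_of_lt hs)]
        rw [integral_mul_const, smul_eq_mul, ← mul_assoc, mul_comm]
        congr 2
        push_cast
        ring
      · simp [Set.indicator_of_notMem hs]
    · refine hi.mul_bdd (c := 1) (by fun_prop) (Filter.Eventually.of_forall fun q => ?_)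
      rw [Complex.norm_exp_ofReal_mul_I]
  simp only [hft]
  have hc := continuous_fourier_of_integrable hgi
  rw [lintegral_comp_mul_left_real (fun w => ‖𝓕 g w‖ₑ ^ 2) (by fun_prop) (by positivity),
    ← eLpNorm_two_sq, eLpNorm_two_fourier_of_integrable hgi, eLpNorm_two_sq,
    ← lintegral_indicator measurableSet_Ioi]
  congr 1
  refine lintegral_congr fun s => ?_
  by_cases hs : s ∈ Set.Ioi (0 : ℝ)
  · simp only [hg, Set.indicator_of_mem hs]
  · simp [hg, Set.indicator_of_notMem hs]

/-- The sharp Cauchy-Schwarz inequality on circles with its remainder. -/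
theorem four_mul_lintegral_add_circularDefect {h : EuclideanSpace ℝ (Fin 2) → ℂ}
    (hi : Integrable h) :
    4 * (∫⁻ t : ℝ, ‖∫ q, h q *
        Complex.exp (((-(8 * Real.pi ^ 2 * t * ‖q‖ ^ 2) : ℝ) : ℂ) * Complex.I)‖ₑ ^ 2)
      + circularDefect h = ∫⁻ q, ‖h q‖ₑ ^ 2 := by
  rw [lintegral_integral_mul_exp_norm_sq hi, lintegral_eq_sqPolar (by fun_prop), circularDefect]
  have hpr := integrable_comp_sqPolar hi
  have hae : ∀ᵐ s ∂(volume.restrict (Set.Ioi (0 : ℝ))),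
      ∫⁻ θ, ‖h (sqPolar (s, θ))‖ₑ ^ 2 ∂angleMeasure
        = ENNReal.ofReal (2 * Real.pi)⁻¹ * ‖∫ θ, h (sqPolar (s, θ)) ∂angleMeasure‖ₑ ^ 2
        + ∫⁻ θ, ‖h (sqPolar (s, θ)) - ⨍ φ, h (sqPolar (s, φ)) ∂angleMeasure‖ₑ ^ 2
          ∂angleMeasure := by
    filter_upwards [hpr.prod_right_ae] with s hs
    rw [lintegral_enorm_sq_eq_variance angleMeasure hs]
    congr 2
    rw [Measure.restrict_apply_univ, Real.volume_Ioo, ENNReal.ofReal_inv_of_pos (by positivity)]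
    congr 2
    ring
  have hmeas : AEMeasurable (fun s => ENNReal.ofReal (2 * Real.pi)⁻¹ *
      ‖∫ θ, h (sqPolar (s, θ)) ∂angleMeasure‖ₑ ^ 2) (volume.restrict (Set.Ioi (0 : ℝ))) :=
    ((hpr.integral_prod_left).aestronglyMeasurable.enorm.pow_const 2).const_mul _
  rw [lintegral_congr_ae hae, lintegral_add_left' hmeas, mul_add]
  congr 1
  have h2 : ∀ s, ‖2⁻¹ * ∫ θ, h (sqPolar (s, θ)) ∂angleMeasure‖ₑ ^ 2
      = ENNReal.ofReal (4⁻¹) * ‖∫ θ, h (sqPolar (s, θ)) ∂angleMeasure‖ₑ ^ 2 := fun s => by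
    rw [enorm_mul, mul_pow, ← ofReal_norm (2⁻¹ : ℂ), ← ENNReal.ofReal_pow (norm_nonneg _)]
    congr 2
    norm_num
  simp only [h2]
  rw [lintegral_const_mul' _ _ ENNReal.ofReal_ne_top, lintegral_const_mul' _ _ ENNReal.ofReal_ne_top,
    ← mul_assoc, ← mul_assoc, ← mul_assoc]
  congr 1
  rw [← ENNReal.ofReal_ofNat 4, ← ENNReal.ofReal_ofNat 2, ← ENNReal.ofReal_inv_of_pos two_pos,
    ← ENNReal.ofReal_mul (by positivity), ← ENNReal.ofReal_mul (by positivity),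
    ← ENNReal.ofReal_mul (by positivity)]
  congr 1
  field_simp
  norm_num

/-! ### The norm identity and the inequality -/

section PairProduct

variable {d : ℕ} {F : EuclideanSpace ℝ (Fin d) → ℂ}

theorem stronglyMeasurable_pairProduct (hF : StronglyMeasurable F) :
    StronglyMeasurable fun z : EuclideanSpace ℝ (Fin d) × EuclideanSpace ℝ (Fin d) =>
      pairProduct F z.1 z.2 :=
  (hF.comp_measurable (by fun_prop)).mul (hF.comp_measurable (by fun_prop))

theorem stronglyMeasurable_pairProduct_left (hF : StronglyMeasurable F)
    (p : EuclideanSpace ℝ (Fin d)) : StronglyMeasurable (pairProduct F p) :=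
  (stronglyMeasurable_pairProduct hF).comp_measurable (g := fun q => (p, q)) measurable_prodMk_left

theorem integrable_pairProduct (hF : MemLp F 2) (p : EuclideanSpace ℝ (Fin d)) :
    Integrable (pairProduct F p) :=
  (hF.comp_measurePreserving (measurePreserving_add_left volume ((2⁻¹ : ℝ) • p))).integrable_mul
    (hF.comp_measurePreserving (Measure.measurePreserving_sub_left volume ((2⁻¹ : ℝ) • p)))

/-- The map `(p, q) ↦ (p/2 + q, p/2 - q)` preserves volume, so the pair product has the norm of
`F ⊗ F`. -/
theorem lintegral_lintegral_pairProduct (hF : StronglyMeasurable F) :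
    ∫⁻ p, ∫⁻ q, ‖pairProduct F p q‖ₑ ^ 2 = (∫⁻ x, ‖F x‖ₑ ^ 2) ^ 2 := by
  have hmp := measurePreserving_halfSum_diff (volume : Measure (EuclideanSpace ℝ (Fin d)))
  have hm : Measurable fun z : EuclideanSpace ℝ (Fin d) × EuclideanSpace ℝ (Fin d) =>
      ‖F z.1‖ₑ ^ 2 * ‖F z.2‖ₑ ^ 2 := by
    have := hF.measurable
    fun_prop
  have h1 := hmp.lintegral_comp hm
  have hFm : AEMeasurable (fun x => ‖F x‖ₑ ^ 2) volume := by
    have := hF.measurable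
    fun_prop
  have hm' := hm.comp hmp.measurable
  simp only [Function.comp_def] at hm'
  rw [lintegral_prod_mul hFm hFm, lintegral_prod _ hm'.aemeasurable] at h1
  rw [sq, ← h1]
  simp only [pairProduct, enorm_mul, mul_pow]

end PairProduct

section Identity

variable (f : Lp ℂ 2 (volume : Measure (EuclideanSpace ℝ (Fin 2))))
  {U : EuclideanSpace ℝ (Fin 2) × ℝ → ℂ}

theorem stronglyMeasurable_integral_pairProduct_mul_exp {F : EuclideanSpace ℝ (Fin 2) → ℂ}
    (hF : StronglyMeasurable F) :
    StronglyMeasurable fun z : EuclideanSpace ℝ (Fin 2) × ℝ => ∫ q, pairProduct F z.1 q *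
        Complex.exp (((-(8 * Real.pi ^ 2 * z.2 * ‖q‖ ^ 2) : ℝ) : ℂ) * Complex.I) := by
  have hs : StronglyMeasurable fun z : (EuclideanSpace ℝ (Fin 2) × ℝ) ×
      EuclideanSpace ℝ (Fin 2) => pairProduct F z.1.1 z.2 *
      Complex.exp (((-(8 * Real.pi ^ 2 * z.1.2 * ‖z.2‖ ^ 2) : ℝ) : ℂ) * Complex.I) := by
    refine ((stronglyMeasurable_pairProduct hF).comp_measurable
      (g := fun z : (EuclideanSpace ℝ (Fin 2) × ℝ) × EuclideanSpace ℝ (Fin 2) => (z.1.1, z.2))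
      (by fun_prop)).mul ?_
    exact Continuous.stronglyMeasurable (by fun_prop)
  exact hs.integral_prod_right'

theorem lintegral_evolution_pow_four (hU : IsSchrodingerEvolution f U) :
    ∫⁻ z, ‖U z‖ₑ ^ 4 = ∫⁻ p, ∫⁻ t : ℝ,
      ‖∫ q, pairProduct (𝓕 f : Lp ℂ 2 (volume : Measure (EuclideanSpace ℝ (Fin 2)))) p q *
        Complex.exp (((-(8 * Real.pi ^ 2 * t * ‖q‖ ^ 2) : ℝ) : ℂ) * Complex.I)‖ₑ ^ 2 := by
  have hs := stronglyMeasurable_integral_pairProduct_mul_exp (Lp.stronglyMeasurable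
    (𝓕 f : Lp ℂ 2 (volume : Measure (EuclideanSpace ℝ (Fin 2)))))
  symm
  rw [Measure.volume_eq_prod, lintegral_prod_symm _ (hU.aestronglyMeasurable.enorm.pow_const 4),
    lintegral_lintegral_swap (hs.enorm.pow_const 2).aemeasurable]
  refine lintegral_congr_ae (hU.slice.mono fun t ht => ?_)
  simp only
  rw [← lintegral_schrodingerPropagator_pow_four]
  refine lintegral_congr_ae ?_
  filter_upwards [ht] with x hx
  rw [hx]

/-- Foschi's identity: four times the fourth power of the `L⁴` norm of the evolution, plus the total
failure of `F(p/2 + q) F(p/2 - q)` to be radial in `q`, is the fourth power of the mass. -/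
theorem four_mul_eLpNorm_evolution_add_defect (hU : IsSchrodingerEvolution f U) :
    4 * eLpNorm U 4 volume ^ 4 + ∫⁻ p, circularDefect (pairProduct
      (𝓕 f : Lp ℂ 2 (volume : Measure (EuclideanSpace ℝ (Fin 2)))) p)
      = eLpNorm f 2 volume ^ 4 := by
  have hm : Measurable fun p => ∫⁻ t : ℝ,
      ‖∫ q, pairProduct (𝓕 f : Lp ℂ 2 (volume : Measure (EuclideanSpace ℝ (Fin 2)))) p q *
        Complex.exp (((-(8 * Real.pi ^ 2 * t * ‖q‖ ^ 2) : ℝ) : ℂ) * Complex.I)‖ₑ ^ 2 :=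
    ((stronglyMeasurable_integral_pairProduct_mul_exp
      (Lp.stronglyMeasurable _)).enorm.pow_const 2).lintegral_prod_right'
  rw [eLpNorm_four_pow, lintegral_evolution_pow_four f hU, ← lintegral_const_mul _ hm,
    ← lintegral_add_left (hm.const_mul 4)]
  simp only [four_mul_lintegral_add_circularDefect (integrable_pairProduct (Lp.memLp
    (𝓕 f : Lp ℂ 2 (volume : Measure (EuclideanSpace ℝ (Fin 2))))) _)]
  rw [lintegral_lintegral_pairProduct (Lp.stronglyMeasurable _), ← eLpNorm_two_sq,
    eLpNorm_fourier_Lp, ← pow_mul]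

theorem measurable_circularDefect_pairProduct {F : EuclideanSpace ℝ (Fin 2) → ℂ}
    (hF : StronglyMeasurable F) : Measurable fun p => circularDefect (pairProduct F p) := by
  have hpair := stronglyMeasurable_pairProduct hF
  have hpol := continuous_sqPolar.measurable
  have hs : StronglyMeasurable fun z : (EuclideanSpace ℝ (Fin 2) × ℝ) × ℝ =>
      pairProduct F z.1.1 (sqPolar (z.1.2, z.2)) :=
    hpair.comp_measurable (g := fun z : (EuclideanSpace ℝ (Fin 2) × ℝ) × ℝ =>
      (z.1.1, sqPolar (z.1.2, z.2))) (by fun_prop)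
  have havg : StronglyMeasurable fun z : EuclideanSpace ℝ (Fin 2) × ℝ =>
      ⨍ φ, pairProduct F z.1 (sqPolar (z.2, φ)) ∂angleMeasure := by
    simp only [average_eq]
    exact hs.integral_prod_right'.const_smul _
  have hd : Measurable fun z : (EuclideanSpace ℝ (Fin 2) × ℝ) × ℝ =>
      ‖pairProduct F z.1.1 (sqPolar (z.1.2, z.2))
        - ⨍ φ, pairProduct F z.1.1 (sqPolar (z.1.2, φ)) ∂angleMeasure‖ₑ ^ 2 :=
    (hs.sub (havg.comp_measurable measurable_fst)).enorm.pow_const 2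
  exact (hd.lintegral_prod_right' (ν := angleMeasure)).lintegral_prod_right'.const_mul _

theorem ofReal_two_rpow_neg_half_pow_four :
    4 * ENNReal.ofReal ((2 : ℝ) ^ (-(1 / 2) : ℝ)) ^ 4 = 1 := by
  rw [← ENNReal.ofReal_pow (by positivity), ← Real.rpow_natCast, ← Real.rpow_mul zero_le_two,
    ← ENNReal.ofReal_ofNat 4, ← ENNReal.ofReal_mul (by norm_num)]
  rw [show (-(1 / 2) * ((4 : ℕ) : ℝ) : ℝ) = ((-2 : ℤ) : ℝ) by norm_num, Real.rpow_intCast]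
  norm_num

/-- The sharp inequality, for data that need not be radial, with its case of equality on the Fourier
side. -/
theorem strichartz_le_and_eq_iff (hU : IsSchrodingerEvolution f U) :
    eLpNorm U 4 volume ≤ ENNReal.ofReal ((2 : ℝ) ^ (-(1 / 2) : ℝ)) * eLpNorm f 2 volume ∧
    (eLpNorm U 4 volume = ENNReal.ofReal ((2 : ℝ) ^ (-(1 / 2) : ℝ)) * eLpNorm f 2 volume ↔
      ∀ᵐ p, circularDefect (pairProduct
        (𝓕 f : Lp ℂ 2 (volume : Measure (EuclideanSpace ℝ (Fin 2)))) p) = 0) := by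
  have hid := four_mul_eLpNorm_evolution_add_defect f hU
  have hm := measurable_circularDefect_pairProduct (Lp.stronglyMeasurable
    (𝓕 f : Lp ℂ 2 (volume : Measure (EuclideanSpace ℝ (Fin 2)))))
  have hzero := lintegral_eq_zero_iff (μ := volume) hm
  set D := ∫⁻ p, circularDefect (pairProduct
    (𝓕 f : Lp ℂ 2 (volume : Measure (EuclideanSpace ℝ (Fin 2)))) p) with hD
  set x := eLpNorm U 4 volume
  set N := eLpNorm f 2 volume with hN
  set c := ENNReal.ofReal ((2 : ℝ) ^ (-(1 / 2) : ℝ))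
  have hNt : N ^ 4 ≠ ⊤ := ENNReal.pow_ne_top (Lp.eLpNorm_ne_top f)
  have hc : 4 * (c * N) ^ 4 = N ^ 4 := by
    rw [mul_pow, ← mul_assoc, ofReal_two_rpow_neg_half_pow_four, one_mul]
  have h4 : ∀ a b : ℝ≥0∞, 4 * a ≤ 4 * b ↔ a ≤ b := fun a b =>
    ENNReal.mul_le_mul_iff_right four_ne_zero ENNReal.ofNat_ne_top
  have hle : x ≤ c * N := by
    rw [← ENNReal.pow_le_pow_left_iff (n := 4) four_ne_zero, ← h4, hc, ← hid]
    exact le_self_add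
  refine ⟨hle, ?_⟩
  change _ ↔ (fun p => circularDefect (pairProduct
    (𝓕 f : Lp ℂ 2 (volume : Measure (EuclideanSpace ℝ (Fin 2)))) p)) =ᵐ[volume] 0
  rw [← hzero]
  constructor
  · intro h
    rw [h, hc] at hid
    have : N ^ 4 + D = N ^ 4 + 0 := by rw [hid, add_zero]
    exact (ENNReal.add_right_inj hNt).1 this
  · intro h
    refine le_antisymm hle ?_
    rw [← ENNReal.pow_le_pow_left_iff (n := 4) four_ne_zero, ← h4, hc, ← hid, h, add_zero]

end Identity

/-! ### Gaussians and radial functions under the Fourier transform -/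

section FourierInvLTwo

theorem continuous_neg_innerₗ (V : Type*) [NormedAddCommGroup V] [InnerProductSpace ℝ V] :
    Continuous fun z : V × V => (-innerₗ V) z.1 z.2 := by
  simp only [LinearMap.neg_apply, innerₗ_apply_apply]
  fun_prop

variable {V : Type*} [NormedAddCommGroup V] [InnerProductSpace ℝ V] [FiniteDimensional ℝ V]
  [MeasurableSpace V] [BorelSpace V]

/-- On `L¹ ∩ L²` the inverse Plancherel transform is given by the inverse Fourier integral. -/
theorem fourierInv_Lp_ae_eq_of_integrable (f : Lp ℂ 2 (volume : Measure V)) {g : V → ℂ}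
    (hg : Integrable g) (hfg : f =ᵐ[volume] g) :
    (𝓕⁻ f : Lp ℂ 2 (volume : Measure V)) =ᵐ[volume] 𝓕⁻ g := by
  have hc : Continuous (𝓕⁻ g) :=
    VectorFourier.fourierIntegral_continuous Real.continuous_fourierChar
      (L := -innerₗ V) (continuous_neg_innerₗ V) hg
  have hbd : ∀ x, ‖𝓕⁻ g x‖ ≤ ∫ v, ‖g v‖ := fun x =>
    VectorFourier.norm_fourierIntegral_le_integral_norm _ _ _ _ _
  refine ae_eq_of_forall_integral_schwartz_mul_eq
    ((Lp.memLp _).locallyIntegrable (by norm_num)) hc.locallyIntegrable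
    (fun φ => φ.integrable_mul_memLp_two (Lp.memLp _))
    (fun φ => φ.integrable.mul_bdd (c := ∫ v, ‖g v‖) hc.aestronglyMeasurable
      (Filter.Eventually.of_forall hbd)) fun φ => ?_
  have h1 := congrArg (fun T => T φ) (Lp.fourierInv_toTemperedDistribution_eq f)
  simp only [TemperedDistribution.fourierInv_apply, Lp.toTemperedDistribution_apply, smul_eq_mul]
    at h1
  have h2 := VectorFourier.integral_fourierIntegral_smul_eq_flip (e := Real.fourierChar)
    (L := -innerₗ V) (μ := volume) (ν := volume) (f := φ) (g := g)
    Real.continuous_fourierChar (continuous_neg_innerₗ V) φ.integrable hg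
  have h3 : (-innerₗ V).flip = -innerₗ V := by
    ext x y
    simp [real_inner_comm]
  rw [h3] at h2
  simp only [smul_eq_mul] at h2
  refine h1.symm.trans (Eq.trans ?_ h2)
  refine integral_congr_ae ?_
  filter_upwards [hfg] with x hx
  rw [hx, SchwartzMap.fourierInv_coe]
  rfl

end FourierInvLTwo

section Gaussian

variable {d : ℕ}

theorem re_pi_sq_div_pos {B : ℂ} (hB : 0 < B.re) : 0 < ((Real.pi : ℂ) ^ 2 / B).re := by
  have hB0 : B ≠ 0 := fun h => by simp [h] at hB
  rw [← Complex.ofReal_pow, div_eq_mul_inv, Complex.re_ofReal_mul, Complex.inv_re]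
  have := Complex.normSq_pos.2 hB0
  positivity

theorem integrable_gaussian {B : ℂ} (hB : 0 < B.re) :
    Integrable fun x : EuclideanSpace ℝ (Fin d) => Complex.exp (-B * ((‖x‖ : ℝ) : ℂ) ^ 2) := by
  simpa using GaussianFourier.integrable_cexp_neg_mul_sq_norm_add hB 0
    (0 : EuclideanSpace ℝ (Fin d))

theorem fourier_const_mul_gaussian (A : ℂ) {B : ℂ} (hB : 0 < B.re) (x : EuclideanSpace ℝ (Fin d)) :
    𝓕 (fun x : EuclideanSpace ℝ (Fin d) => A * Complex.exp (-B * ((‖x‖ : ℝ) : ℂ) ^ 2)) x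
      = A * (Real.pi / B) ^ ((Module.finrank ℝ (EuclideanSpace ℝ (Fin d)) : ℂ) / 2) *
        Complex.exp (-(Real.pi ^ 2 / B) * ((‖x‖ : ℝ) : ℂ) ^ 2) := by
  have h := fourier_gaussian_innerProductSpace hB x
  rw [mul_assoc]
  rw [Real.fourier_eq] at h ⊢
  simp only [Circle.smul_def, smul_eq_mul, mul_left_comm _ A] at h ⊢
  rw [integral_const_mul, h]
  congr 3
  ring

theorem fourier_Lp_gaussian (f : Lp ℂ 2 (volume : Measure (EuclideanSpace ℝ (Fin d)))) {A B : ℂ}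
    (hB : 0 < B.re) (hf : f =ᵐ[volume] fun x => A * Complex.exp (-B * ((‖x‖ : ℝ) : ℂ) ^ 2)) :
    ∃ A' B' : ℂ, 0 < B'.re ∧ (𝓕 f : Lp ℂ 2 (volume : Measure (EuclideanSpace ℝ (Fin d))))
      =ᵐ[volume] fun x => A' * Complex.exp (-B' * ((‖x‖ : ℝ) : ℂ) ^ 2) := by
  refine ⟨A * (Real.pi / B) ^ ((Module.finrank ℝ (EuclideanSpace ℝ (Fin d)) : ℂ) / 2),
    Real.pi ^ 2 / B, re_pi_sq_div_pos hB, ?_⟩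
  filter_upwards [fourier_Lp_ae_eq_of_integrable f ((integrable_gaussian hB).const_mul A) hf]
    with x hx
  rw [hx, fourier_const_mul_gaussian A hB]

theorem fourierInv_Lp_gaussian (f : Lp ℂ 2 (volume : Measure (EuclideanSpace ℝ (Fin d)))) {A B : ℂ}
    (hB : 0 < B.re) (hf : f =ᵐ[volume] fun x => A * Complex.exp (-B * ((‖x‖ : ℝ) : ℂ) ^ 2)) :
    ∃ A' B' : ℂ, 0 < B'.re ∧ (𝓕⁻ f : Lp ℂ 2 (volume : Measure (EuclideanSpace ℝ (Fin d))))
      =ᵐ[volume] fun x => A' * Complex.exp (-B' * ((‖x‖ : ℝ) : ℂ) ^ 2) := by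
  refine ⟨A * (Real.pi / B) ^ ((Module.finrank ℝ (EuclideanSpace ℝ (Fin d)) : ℂ) / 2),
    Real.pi ^ 2 / B, re_pi_sq_div_pos hB, ?_⟩
  filter_upwards [fourierInv_Lp_ae_eq_of_integrable f ((integrable_gaussian hB).const_mul A) hf]
    with x hx
  rw [hx, Real.fourierInv_eq_fourier_neg, fourier_const_mul_gaussian A hB, norm_neg]

/-- The circular defect vanishes exactly when the function is constant on almost every circle. -/
theorem circularDefect_eq_zero_iff {h : EuclideanSpace ℝ (Fin 2) → ℂ} (hm : StronglyMeasurable h) :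
    circularDefect h = 0 ↔ ∀ᵐ s ∂(volume.restrict (Set.Ioi (0 : ℝ))), ∀ᵐ θ ∂angleMeasure,
      h (sqPolar (s, θ)) = ⨍ φ, h (sqPolar (s, φ)) ∂angleMeasure := by
  have hs : StronglyMeasurable fun z : ℝ × ℝ => h (sqPolar z) :=
    hm.comp_measurable continuous_sqPolar.measurable
  have havg : StronglyMeasurable fun s : ℝ => ⨍ φ, h (sqPolar (s, φ)) ∂angleMeasure := by
    simp only [average_eq]
    exact hs.integral_prod_right'.const_smul _
  have hd : Measurable fun z : ℝ × ℝ =>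
      ‖h (sqPolar z) - ⨍ φ, h (sqPolar (z.1, φ)) ∂angleMeasure‖ₑ ^ 2 :=
    (hs.sub (havg.comp_measurable measurable_fst)).enorm.pow_const 2
  rw [circularDefect, mul_eq_zero, or_iff_right (by simp),
    lintegral_eq_zero_iff hd.lintegral_prod_right']
  refine Filter.eventually_congr (Filter.Eventually.of_forall fun s => ?_)
  simp only [Pi.zero_apply]
  have hds : Measurable fun θ : ℝ =>
      ‖h (sqPolar (s, θ)) - ⨍ φ, h (sqPolar (s, φ)) ∂angleMeasure‖ₑ ^ 2 :=
    hd.comp measurable_prodMk_left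
  rw [lintegral_eq_zero_iff hds]
  refine Filter.eventually_congr (Filter.Eventually.of_forall fun θ => ?_)
  simp [sub_eq_zero]

/-- For a Gaussian, `F(p/2 + q) F(p/2 - q)` depends on `q` only through `‖q‖`. -/
theorem circularDefect_pairProduct_gaussian {F : EuclideanSpace ℝ (Fin 2) → ℂ}
    (hF : StronglyMeasurable F) {A B : ℂ}
    (h : F =ᵐ[volume] fun x => A * Complex.exp (-B * ((‖x‖ : ℝ) : ℂ) ^ 2))
    (p : EuclideanSpace ℝ (Fin 2)) : circularDefect (pairProduct F p) = 0 := by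
  have hq1 := (measurePreserving_add_left volume
    ((2⁻¹ : ℝ) • p)).quasiMeasurePreserving.ae h
  have hq2 := (Measure.measurePreserving_sub_left volume
    ((2⁻¹ : ℝ) • p)).quasiMeasurePreserving.ae h
  have hq : ∀ᵐ q, pairProduct F p q = A ^ 2 *
      Complex.exp (-B * ((2⁻¹ * ‖p‖ ^ 2 + 2 * ‖q‖ ^ 2 : ℝ) : ℂ)) := by
    filter_upwards [hq1, hq2] with q h1 h2
    have h3 := parallelogram_law_with_norm ℝ ((2⁻¹ : ℝ) • p) q
    rw [norm_smul] at h3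
    have h' : 2⁻¹ * ‖p‖ ^ 2 + 2 * ‖q‖ ^ 2 =
        ‖(2⁻¹ : ℝ) • p + q‖ ^ 2 + ‖(2⁻¹ : ℝ) • p - q‖ ^ 2 := by
      norm_num at h3
      nlinarith
    rw [pairProduct, h1, h2, h', mul_mul_mul_comm, ← Complex.exp_add, sq A]
    congr 2
    push_cast
    ring
  have hpol := ae_sqPolarMeasure_iff.1 (measurePreserving_sqPolar.quasiMeasurePreserving.ae hq)
  rw [circularDefect_eq_zero_iff (stronglyMeasurable_pairProduct_left hF p)]
  filter_upwards [Measure.ae_ae_of_ae_prod hpol, ae_restrict_mem measurableSet_Ioi] with s hs hs0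
  have hs' : ∀ᵐ θ ∂angleMeasure, pairProduct F p (sqPolar (s, θ)) = A ^ 2 *
      Complex.exp (-B * ((2⁻¹ * ‖p‖ ^ 2 + 2 * s : ℝ) : ℂ)) := by
    filter_upwards [hs] with θ hθ
    rw [hθ, norm_sq_sqPolar (le_of_lt hs0)]
  filter_upwards [hs'] with θ hθ
  rw [hθ, average_congr hs', average_const]

end Gaussian

section Radial

theorem ae_of_ae_sqPolar {P : EuclideanSpace ℝ (Fin 2) → Prop} (hP : MeasurableSet {x | P x})
    (h : ∀ᵐ z ∂(volume.restrict (Set.Ioi (0 : ℝ))).prod angleMeasure, P (sqPolar z)) :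
    ∀ᵐ x, P x := by
  rw [← measurePreserving_sqPolar.map_eq, ae_map_iff continuous_sqPolar.aemeasurable hP,
    ae_sqPolarMeasure_iff]
  exact h

/-- Rotation of the plane by the angle `φ`. -/
noncomputable def planeRotation (φ : ℝ) :
    EuclideanSpace ℝ (Fin 2) ≃ₗᵢ[ℝ] EuclideanSpace ℝ (Fin 2) :=
  (Complex.orthonormalBasisOneI.repr.symm.trans (rotation (Circle.exp φ))).trans
    Complex.orthonormalBasisOneI.repr

theorem planeRotation_sqPolar (φ s θ : ℝ) :
    planeRotation φ (sqPolar (s, θ)) = sqPolar (s, θ + φ) := by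
  ext i
  fin_cases i <;>
  simp [planeRotation, sqPolar, Complex.orthonormalBasisOneI_repr_apply,
    Complex.orthonormalBasisOneI_repr_symm_apply, Real.cos_add, Real.sin_add,
    Complex.cos_ofReal_re, Complex.sin_ofReal_re, Complex.exp_ofReal_mul_I_re, Complex.exp_ofReal_mul_I_im] <;> ring

/-- The Fourier transform of a radial function is radial: it is invariant under every rotation,
hence by Fubini constant on almost every circle. The profile is a measurable function of `‖x‖²`. -/
theorem exists_radial_profile_of_isRadial
    {f : Lp ℂ 2 (volume : Measure (EuclideanSpace ℝ (Fin 2)))} (hf : IsRadial f) :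
    ∃ G : ℝ → ℂ, StronglyMeasurable G ∧
      ∀ᵐ x, (𝓕 f : Lp ℂ 2 (volume : Measure (EuclideanSpace ℝ (Fin 2)))) x = G (‖x‖ ^ 2) := by
  obtain ⟨ρ, hρ⟩ := hf
  set F := (𝓕 f : Lp ℂ 2 (volume : Measure (EuclideanSpace ℝ (Fin 2)))) with hFdef
  have hFm : StronglyMeasurable F := Lp.stronglyMeasurable F
  have hinv : ∀ φ : ℝ, ∀ᵐ z ∂(volume.restrict (Set.Ioi (0 : ℝ))).prod angleMeasure,
      F (sqPolar z) = F (sqPolar (z.1, z.2 + φ)) := by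
    intro φ
    have h1 : f =ᵐ[volume] fun x => f (planeRotation φ x) := by
      filter_upwards [hρ,
        (planeRotation φ).measurePreserving.quasiMeasurePreserving.ae hρ] with x hx hx'
      rw [hx, hx', LinearIsometryEquiv.norm_map]
    have h2 := fourier_Lp_comp_linearIsometryEquiv (planeRotation φ) f f h1
    have h3 := ae_sqPolarMeasure_iff.1 (measurePreserving_sqPolar.quasiMeasurePreserving.ae h2)
    filter_upwards [h3] with z hz
    rw [← planeRotation_sqPolar]
    exact hz
  have hms : MeasurableSet {w : ℝ × (ℝ × ℝ) |
      F (sqPolar w.2) = F (sqPolar (w.2.1, w.2.2 + w.1))} := by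
    have hFm' := hFm.measurable
    have hpol := continuous_sqPolar.measurable
    exact measurableSet_eq_fun (by fun_prop) (by fun_prop)
  have h4 := (Measure.ae_ae_comm (μ := (volume : Measure ℝ))
    (ν := (volume.restrict (Set.Ioi (0 : ℝ))).prod angleMeasure) hms).1
    (Filter.Eventually.of_forall hinv)
  have h5 := Measure.ae_ae_of_ae_prod h4
  have hs : StronglyMeasurable fun z : ℝ × ℝ => F (sqPolar z) :=
    hFm.comp_measurable continuous_sqPolar.measurable
  have havg : StronglyMeasurable fun s : ℝ => ⨍ φ, F (sqPolar (s, φ)) ∂angleMeasure := by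
    simp only [average_eq]
    exact hs.integral_prod_right'.const_smul _
  refine ⟨_, havg, ?_⟩
  have h6 : ∀ᵐ s ∂(volume.restrict (Set.Ioi (0 : ℝ))), ∀ᵐ θ ∂angleMeasure,
      F (sqPolar (s, θ)) = ⨍ φ, F (sqPolar (s, φ)) ∂angleMeasure := by
    filter_upwards [h5] with s hs
    obtain ⟨θ₀, hθ₀⟩ := hs.exists
    have h7 : ∀ᵐ ψ : ℝ, F (sqPolar (s, θ₀)) = F (sqPolar (s, ψ)) := by
      have := (measurePreserving_sub_right (volume : Measure ℝ) θ₀).quasiMeasurePreserving.ae hθ₀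
      filter_upwards [this] with ψ hψ
      simpa using hψ
    have h8 : ∀ᵐ ψ ∂angleMeasure, F (sqPolar (s, ψ)) = F (sqPolar (s, θ₀)) := by
      filter_upwards [ae_restrict_of_ae h7] with ψ hψ
      exact hψ.symm
    filter_upwards [h8] with θ hθ
    rw [hθ, average_congr h8, average_const]
  refine ae_of_ae_sqPolar ?_ ?_
  · exact measurableSet_eq_fun hFm.measurable (havg.measurable.comp (by fun_prop))
  · have hms2 : MeasurableSet {z : ℝ × ℝ |
        F (sqPolar z) = ⨍ φ, F (sqPolar (z.1, φ)) ∂angleMeasure} :=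
      measurableSet_eq_fun hs.measurable (havg.measurable.comp measurable_fst)
    have h9 := (Measure.ae_prod_mem_iff_ae_ae_mem hms2).2 h6
    have h10 : ∀ᵐ z ∂(volume.restrict (Set.Ioi (0 : ℝ))).prod angleMeasure, 0 < z.1 := by
      refine (Measure.ae_prod_mem_iff_ae_ae_mem
        (s := {z : ℝ × ℝ | 0 < z.1}) (measurableSet_lt measurable_const measurable_fst)).2 ?_
      filter_upwards [ae_restrict_mem measurableSet_Ioi] with s hs
      exact Filter.Eventually.of_forall fun _ => hs
    filter_upwards [h9, h10] with z hz hz0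
    have := norm_sq_sqPolar hz0.le z.2
    rw [Prod.mk.eta] at this
    rw [this]
    exact hz

end Radial

/-! ### Existence of the space-time function -/

section Existence

theorem ae_tendsto_of_tsum_lintegral_enorm_sq_ne_top {α : Type*} [MeasurableSpace α]
    {μ : Measure α} {u : ℕ → α → ℂ} {g : α → ℂ} (hu : ∀ n, AEStronglyMeasurable (u n) μ)
    (hg : AEStronglyMeasurable g μ) (h : ∑' n, ∫⁻ x, ‖u n x - g x‖ₑ ^ 2 ∂μ ≠ ⊤) :
    ∀ᵐ x ∂μ, Filter.Tendsto (fun n => u n x) Filter.atTop (nhds (g x)) := by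
  have hm : ∀ n, AEMeasurable (fun x => ‖u n x - g x‖ₑ ^ 2) μ := fun n =>
    ((hu n).sub hg).enorm.pow_const 2
  rw [← lintegral_tsum hm] at h
  filter_upwards [ae_lt_top' (AEMeasurable.tsum hm) h] with x hx
  have h1 := ENNReal.tendsto_atTop_zero_of_tsum_ne_top hx.ne
  have h2 : Filter.Tendsto (fun n => ‖u n x - g x‖ₑ) Filter.atTop (nhds 0) := by
    have := (ENNReal.continuous_rpow_const (y := (1 / 2 : ℝ))).tendsto 0 |>.comp h1
    simp only [Function.comp_def, ← ENNReal.rpow_natCast, ← ENNReal.rpow_mul] at this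
    simpa using this
  rw [tendsto_iff_norm_sub_tendsto_zero]
  have h3 := (ENNReal.tendsto_toReal ENNReal.zero_ne_top).comp h2
  simpa [Function.comp_def] using h3

variable {d : ℕ}

/-- The integral formula for the propagator applied to a datum whose Fourier transform is a Schwartz
function, as a function of time and space. -/
noncomputable def schwartzEvolution (φ : 𝓢(EuclideanSpace ℝ (Fin d), ℂ))
    (z : ℝ × EuclideanSpace ℝ (Fin d)) : ℂ :=
  𝓕⁻ (fun ξ => schrodingerSymbol d z.1 ξ * φ ξ) z.2

theorem continuous_schwartzEvolution (φ : 𝓢(EuclideanSpace ℝ (Fin d), ℂ)) :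
    Continuous (schwartzEvolution φ) := by
  unfold schwartzEvolution
  simp only [Real.fourierInv_eq]
  refine continuous_of_dominated (bound := fun ξ => ‖φ ξ‖) (fun z => ?_) (fun z => ?_)
    φ.integrable.norm (Filter.Eventually.of_forall fun ξ => ?_)
  · have hc : Continuous fun ξ : EuclideanSpace ℝ (Fin d) => inner ℝ ξ z.2 := by fun_prop
    have h1 := continuous_subtype_val.comp (Real.continuous_fourierChar.comp hc)
    exact (h1.mul ((continuous_schrodingerSymbol d z.1).mul φ.continuous)).aestronglyMeasurable
  · refine Filter.Eventually.of_forall fun ξ => ?_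
    rw [Circle.norm_smul, norm_mul, norm_schrodingerSymbol, one_mul]
  · have hc : Continuous fun z : ℝ × EuclideanSpace ℝ (Fin d) => inner ℝ ξ z.2 := by fun_prop
    have h1 := continuous_subtype_val.comp (Real.continuous_fourierChar.comp hc)
    have h2 : Continuous fun z : ℝ × EuclideanSpace ℝ (Fin d) => schrodingerSymbol d z.1 ξ := by
      unfold schrodingerSymbol
      fun_prop
    exact h1.mul (h2.mul continuous_const)

theorem lintegral_schwartzEvolution_sub (φ : 𝓢(EuclideanSpace ℝ (Fin d), ℂ)) (t : ℝ)
    (f : Lp ℂ 2 (volume : Measure (EuclideanSpace ℝ (Fin d)))) :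
    ∫⁻ x, ‖schwartzEvolution φ (t, x) - schrodingerPropagator t f x‖ₑ ^ 2
      = ‖φ.toLp 2 volume - 𝓕 f‖ₑ ^ 2 := by
  have hm : MemLp (fun ξ => schrodingerSymbol d t ξ * φ ξ) 2 volume := by
    refine (φ.memLp 2).of_le ((continuous_schrodingerSymbol d t).mul
      φ.continuous).aestronglyMeasurable (Filter.Eventually.of_forall fun ξ => ?_)
    rw [Pi.mul_apply, norm_mul, norm_schrodingerSymbol, one_mul]
  have hi : Integrable (fun ξ => schrodingerSymbol d t ξ * φ ξ) := by
    refine φ.integrable.mono ((continuous_schrodingerSymbol d t).mul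
      φ.continuous).aestronglyMeasurable (Filter.Eventually.of_forall fun ξ => ?_)
    rw [norm_mul, norm_schrodingerSymbol, one_mul]
  set w := hm.toLp _ with hw
  have h1 := fourierInv_Lp_ae_eq_of_integrable w hi hm.coeFn_toLp
  set k := 𝓕⁻ w - schrodingerPropagator t f with hk
  have h2 : ∫⁻ x, ‖schwartzEvolution φ (t, x) - schrodingerPropagator t f x‖ₑ ^ 2
      = eLpNorm k 2 volume ^ 2 := by
    rw [eLpNorm_two_sq]
    refine lintegral_congr_ae ?_
    filter_upwards [h1, Lp.coeFn_sub (𝓕⁻ w) (schrodingerPropagator t f)] with x h3 h4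
    rw [hk, h4, Pi.sub_apply, h3, schwartzEvolution]
  have h3 : 𝓕 k = w - 𝓕 (schrodingerPropagator t f) := by
    have h := map_sub (Lp.fourierTransformₗᵢ (EuclideanSpace ℝ (Fin d)) ℂ) (𝓕⁻ w)
      (schrodingerPropagator t f)
    have h' : 𝓕 (𝓕⁻ w) = w := fourier_fourierInv_eq w
    change 𝓕 k = 𝓕 (𝓕⁻ w) - 𝓕 (schrodingerPropagator t f) at h
    rw [h, h']
  rw [h2, ← eLpNorm_fourier_Lp, h3, Lp.enorm_def, eLpNorm_two_sq, eLpNorm_two_sq]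
  refine lintegral_congr_ae ?_
  filter_upwards [Lp.coeFn_sub w (𝓕 (schrodingerPropagator t f)), hm.coeFn_toLp,
    fourier_schrodingerPropagator t f, Lp.coeFn_sub (φ.toLp 2 volume) (𝓕 f),
    φ.coeFn_toLp 2 volume] with ξ h4 h5 h6 h7 h8
  rw [h4, h7, Pi.sub_apply, Pi.sub_apply, hw, h5, h6, h8, ← mul_sub, enorm_mul, ← ofReal_norm,
    norm_schrodingerSymbol, ENNReal.ofReal_one, one_mul]

/-- The time slices have a jointly measurable version: approximate `𝓕 f` by Schwartz functions so
fast that the approximate solutions, which are continuous in `(t, x)`, converge almost everywhere at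
each time. -/
theorem exists_isSchrodingerEvolution
    (f : Lp ℂ 2 (volume : Measure (EuclideanSpace ℝ (Fin d)))) :
    ∃ U : EuclideanSpace ℝ (Fin d) × ℝ → ℂ, IsSchrodingerEvolution f U := by
  have hdense : ∀ n : ℕ, ∃ φ : 𝓢(EuclideanSpace ℝ (Fin d), ℂ),
      ‖φ.toLp 2 volume - 𝓕 f‖ < (1 / 2 : ℝ) ^ n := fun n => by
    have := (SchwartzMap.denseRange_toLpCLM (E := EuclideanSpace ℝ (Fin d)) (F := ℂ) (p := 2)
      (μ := volume) ENNReal.ofNat_ne_top).exists_dist_lt (𝓕 f) (ε := (1 / 2 : ℝ) ^ n)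
      (by positivity)
    obtain ⟨φ, hφ⟩ := this
    rw [dist_comm, dist_eq_norm] at hφ
    exact ⟨φ, hφ⟩
  choose φ hφ using hdense
  have hlim : ∀ t : ℝ, ∀ᵐ x, Filter.Tendsto (fun n => schwartzEvolution (φ n) (t, x))
      Filter.atTop (nhds (schrodingerPropagator t f x)) := fun t => by
    refine ae_tendsto_of_tsum_lintegral_enorm_sq_ne_top (fun n => ?_)
      (Lp.aestronglyMeasurable _) ?_
    · exact ((continuous_schwartzEvolution (φ n)).comp
        (Continuous.prodMk_right t)).aestronglyMeasurable
    · simp only [lintegral_schwartzEvolution_sub]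
      have hs : Summable fun n : ℕ => ((1 / 2 : ℝ) ^ n) ^ 2 := by
        simp only [← pow_mul, mul_comm _ 2]
        simp only [pow_mul]
        exact summable_geometric_of_lt_one (by norm_num) (by norm_num)
      have hb := hs.tsum_ofReal_ne_top
      refine ne_top_of_le_ne_top hb (ENNReal.tsum_le_tsum fun n => ?_)
      rw [← ofReal_norm, ← ENNReal.ofReal_pow (norm_nonneg _)]
      exact ENNReal.ofReal_le_ofReal (pow_le_pow_left₀ (norm_nonneg _) (hφ n).le 2)
  have hms : MeasurableSet {z : ℝ × EuclideanSpace ℝ (Fin d) |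
      ∃ l, Filter.Tendsto (fun n => schwartzEvolution (φ n) z) Filter.atTop (nhds l)} :=
    measurableSet_exists_tendsto fun n => (continuous_schwartzEvolution (φ n)).measurable
  have hex : ∀ᵐ z : ℝ × EuclideanSpace ℝ (Fin d) ∂(volume.prod volume),
      ∃ l, Filter.Tendsto (fun n => schwartzEvolution (φ n) z) Filter.atTop (nhds l) :=
    (Measure.ae_prod_mem_iff_ae_ae_mem hms).2
      (Filter.Eventually.of_forall fun t => (hlim t).mono fun x hx => ⟨_, hx⟩)
  obtain ⟨W, hWm, hW⟩ := exists_stronglyMeasurable_limit_of_tendsto_ae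
    (fun n => (continuous_schwartzEvolution (φ n)).aestronglyMeasurable) hex
  refine ⟨fun z => W z.swap, (hWm.comp_measurable measurable_swap).aestronglyMeasurable, ?_⟩
  filter_upwards [Measure.ae_ae_of_ae_prod hW] with t ht
  filter_upwards [ht, hlim t] with x h1 h2
  exact tendsto_nhds_unique h1 h2

end Existence

/-! ### The functional equation on the half-line -/

section FunctionalEquation

/-- A differentiable function on the line that is multiplicative on `[0, ∞)` is an exponential
there. -/
theorem eq_exp_of_differentiable_of_mul {k : ℝ → ℂ} (hk : Differentiable ℝ k) (h0 : k 0 = 1)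
    (hmul : ∀ x y : ℝ, 0 ≤ x → 0 ≤ y → k (x + y) = k x * k y) :
    ∃ c : ℂ, ∀ x : ℝ, 0 ≤ x → k x = Complex.exp (c * x) := by
  set c := deriv k 0 with hc
  refine ⟨c, fun x hx => ?_⟩
  have hder : ∀ y : ℝ, 0 ≤ y → HasDerivAt k (c * k y) y := by
    intro y hy
    have h1 : HasDerivWithinAt (fun z => k (y + z)) (deriv k y) (Set.Ici 0) 0 := by
      have := (hk y).hasDerivAt
      rw [← add_zero y] at this
      simpa using (this.comp_const_add y 0).hasDerivWithinAt
    have h2 : HasDerivWithinAt (fun z => k (y + z)) (k y * c) (Set.Ici 0) 0 :=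
      ((hk 0).hasDerivAt.const_mul (k y)).hasDerivWithinAt.congr
        (fun z hz => hmul y z hy hz) (hmul y 0 hy le_rfl)
    have h3 := (uniqueDiffWithinAt_Ici (0 : ℝ)).eq_deriv _ h1 h2
    rw [mul_comm, ← h3]
    exact (hk y).hasDerivAt
  have hexp : ∀ y : ℝ, HasDerivAt (fun y : ℝ => Complex.exp (-(c * y)))
      (Complex.exp (-(c * y)) * -c) y := fun y => by
    have h1 : HasDerivAt (fun y : ℝ => -(c * (y : ℂ))) (-(c * 1)) y :=
      ((hasDerivAt_id y).ofReal_comp.const_mul c).neg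
    simpa using h1.cexp
  have hconst := constant_of_has_deriv_right_zero
    (f := fun y : ℝ => k y * Complex.exp (-(c * y))) (a := 0) (b := x)
    (by have := hk.continuous; fun_prop)
    (fun y hy => by
      have := ((hder y hy.1).mul (hexp y)).hasDerivWithinAt (s := Set.Ici y)
      refine this.congr_deriv ?_
      ring) x (Set.right_mem_Icc.2 hx)
  simp only [h0, Complex.ofReal_zero, mul_zero, neg_zero, Complex.exp_zero, mul_one] at hconst
  rw [Complex.exp_neg, mul_inv_eq_one₀ (Complex.exp_ne_zero _)] at hconst
  exact hconst

/-- A function on `(0, ∞)` unchanged, almost everywhere, by each positive translation is almost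
everywhere constant. -/
theorem ae_eq_const_of_translation_invariant {L : ℝ → ℂ} (hL : StronglyMeasurable L)
    (h : ∀ δ : ℝ, 0 < δ → ∀ᵐ s ∂(volume.restrict (Set.Ioi (0 : ℝ))), L (s + δ) = L s) :
    ∃ A : ℂ, ∀ᵐ s ∂(volume.restrict (Set.Ioi (0 : ℝ))), L s = A := by
  have hLm := hL.measurable
  have hm1 : MeasurableSet {w : ℝ × ℝ | 0 < w.1 → L (w.2 + w.1) = L w.2} := by
    have : {w : ℝ × ℝ | 0 < w.1 → L (w.2 + w.1) = L w.2}
        = {w : ℝ × ℝ | 0 < w.1}ᶜ ∪ {w : ℝ × ℝ | L (w.2 + w.1) = L w.2} := by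
      ext w; simp [imp_iff_not_or]
    rw [this]
    exact (measurableSet_lt measurable_const measurable_fst).compl.union
      (measurableSet_eq_fun (by fun_prop) (by fun_prop))
  have h0 : ∀ᵐ δ : ℝ, ∀ᵐ s ∂(volume.restrict (Set.Ioi (0 : ℝ))), 0 < δ → L (s + δ) = L s := by
    refine Filter.Eventually.of_forall fun δ => ?_
    by_cases hδ : 0 < δ
    · exact (h δ hδ).mono fun s hs _ => hs
    · exact Filter.Eventually.of_forall fun s hs => absurd hs hδ
  have h1 := (Measure.ae_ae_comm hm1).1 h0
  have h2 : ∀ᵐ s ∂(volume.restrict (Set.Ioi (0 : ℝ))),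
      ∀ᵐ t ∂(volume.restrict (Set.Ioi (0 : ℝ))), s < t → L t = L s := by
    filter_upwards [h1] with s hs
    refine ae_restrict_of_ae ?_
    filter_upwards [(measurePreserving_sub_right (volume : Measure ℝ)
      s).quasiMeasurePreserving.ae hs] with t ht hst
    simpa using ht (sub_pos.2 hst)
  have hm2 : MeasurableSet {w : ℝ × ℝ | w.1 < w.2 → L w.2 = L w.1} := by
    have : {w : ℝ × ℝ | w.1 < w.2 → L w.2 = L w.1}
        = {w : ℝ × ℝ | w.1 < w.2}ᶜ ∪ {w : ℝ × ℝ | L w.2 = L w.1} := by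
      ext w; simp [imp_iff_not_or]
    rw [this]
    exact (measurableSet_lt measurable_fst measurable_snd).compl.union
      (measurableSet_eq_fun (by fun_prop) (by fun_prop))
  have h3 := (Measure.ae_ae_comm hm2).1 h2
  have hne : NeZero (volume.restrict (Set.Ioi (0 : ℝ))) := ⟨by simp⟩
  obtain ⟨s, hs⟩ := (h2.and h3).exists
  refine ⟨L s, ?_⟩
  filter_upwards [hs.1, hs.2, ae_restrict_of_ae (Measure.ae_ne volume s)] with t ht1 ht2 hne
  rcases lt_or_gt_of_ne hne with hlt | hgt
  · exact (ht2 hlt).symm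
  · exact ht1 hgt

/-- Nonzero square-integrable solutions of `G(s + δ) G(t) = G(s) G(t + δ)` on the half-line are
exponentials: averaging over `t` yields `G(s + δ) = G(s) k(δ)` with `k` smooth and
multiplicative. -/
theorem ae_eq_const_mul_exp_of_shift {G : ℝ → ℂ} (hG : StronglyMeasurable G)
    (hG2 : MemLp G 2 (volume.restrict (Set.Ioi (0 : ℝ))))
    (hne : ¬ ∀ᵐ s ∂(volume.restrict (Set.Ioi (0 : ℝ))), G s = 0)
    (h : ∀ δ : ℝ, 0 < δ → ∀ᵐ s ∂(volume.restrict (Set.Ioi (0 : ℝ))),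
      ∀ᵐ t ∂(volume.restrict (Set.Ioi (0 : ℝ))), G (s + δ) * G t = G s * G (t + δ)) :
    ∃ A c : ℂ, ∀ᵐ s ∂(volume.restrict (Set.Ioi (0 : ℝ))), G s = A * Complex.exp (c * s) := by
  set G₀ : ℝ → ℂ := (Set.Ioi (0 : ℝ)).indicator G with hG₀
  have hloc : LocallyIntegrable G₀ := by
    have : MemLp G₀ 2 volume := (memLp_indicator_iff_restrict measurableSet_Ioi).2 hG2
    exact this.locallyIntegrable (by norm_num)
  -- A test function supported in `(0, ∞)` against which `G` does not integrate to zero.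
  obtain ⟨g, hgs, hgc, hgU, hgI⟩ : ∃ g : ℝ → ℝ, ContDiff ℝ ∞ g ∧ HasCompactSupport g ∧
      tsupport g ⊆ Set.Ioi 0 ∧ ∫ x, g x • G₀ x ≠ 0 := by
    by_contra hcon
    push Not at hcon
    apply hne
    rw [ae_restrict_iff' measurableSet_Ioi]
    have := isOpen_Ioi.ae_eq_zero_of_integral_contDiff_smul_eq_zero
      (hloc.locallyIntegrableOn (Set.Ioi (0 : ℝ))) hcon
    filter_upwards [this] with s hs hs0
    have := hs hs0
    rwa [hG₀, Set.indicator_of_mem hs0] at this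
  have hg0 : ∀ t, t ≤ 0 → g t = 0 := fun t ht =>
    image_eq_zero_of_notMem_tsupport fun hmem => absurd (hgU hmem) (not_lt.2 ht)
  set I := ∫ x, g x • G₀ x with hI
  -- `K δ = ∫ g(t) G(t + δ) dt`, written so that its smoothness comes from that of `g`.
  set K : ℝ → ℂ := fun δ => ∫ t, g (t - δ) • G₀ t with hK
  have hKdiff : Differentiable ℝ K := by
    have hgn : ContDiff ℝ 1 (fun x => g (-x)) := by
      have : ContDiff ℝ 1 g := hgs.of_le (by exact_mod_cast le_top)
      fun_prop
    have hgnc : HasCompactSupport (fun x => g (-x)) := hgc.comp_homeomorph (Homeomorph.neg ℝ)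
    have hKc : K = convolution G₀ (fun x => g (-x))
        (ContinuousLinearMap.lsmul ℝ ℝ : ℝ →L[ℝ] ℂ →L[ℝ] ℂ).flip volume := by
      funext δ
      simp only [hK, convolution_def, ContinuousLinearMap.flip_apply,
        ContinuousLinearMap.lsmul_apply, neg_sub]
    rw [hKc]
    exact (hgnc.contDiff_convolution_right _ hloc hgn).differentiable one_ne_zero
  have hKform : ∀ δ, 0 ≤ δ → K δ = ∫ t in Set.Ioi (0 : ℝ), g t * G (t + δ) := fun δ hδ => by
    rw [← integral_indicator measurableSet_Ioi, hK]
    simp only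
    rw [← integral_add_right_eq_self _ δ]
    refine integral_congr_ae (Filter.Eventually.of_forall fun t => ?_)
    by_cases ht : t ∈ Set.Ioi (0 : ℝ)
    · have ht' : t + δ ∈ Set.Ioi (0 : ℝ) := add_pos_of_pos_of_nonneg ht hδ
      simp [hG₀, Set.indicator_of_mem ht, Set.indicator_of_mem ht']
    · simp [Set.indicator_of_notMem ht, hg0 t (not_lt.1 ht)]
  have hK0 : K 0 = I := by simp [hK, hI]
  have hshift : ∀ δ, 0 ≤ δ → ∀ᵐ s ∂(volume.restrict (Set.Ioi (0 : ℝ))),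
      G (s + δ) = G s * (K δ / I) := fun δ hδ => by
    rcases hδ.eq_or_lt with rfl | hδ
    · rw [hK0, div_self hgI]
      simp
    filter_upwards [h δ hδ] with s hs
    rw [← mul_div_assoc, eq_div_iff hgI, hKform δ hδ.le, ← hK0, hKform 0 le_rfl,
      ← integral_const_mul, ← integral_const_mul]
    refine integral_congr_ae ?_
    filter_upwards [hs] with t ht
    simp only [add_zero]
    linear_combination (g t : ℂ) * ht
  have hmul : ∀ x y : ℝ, 0 ≤ x → 0 ≤ y → K (x + y) / I = K x / I * (K y / I) := by
    intro x y hx hy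
    rw [div_mul_eq_mul_div]
    congr 1
    rw [hKform _ (add_nonneg hx hy), hKform _ hx, ← integral_mul_const]
    refine integral_congr_ae ?_
    have h1 : ∀ᵐ s : ℝ, s + x ∈ Set.Ioi (0 : ℝ) → G (s + x + y) = G (s + x) * (K y / I) :=
      (measurePreserving_add_right (volume : Measure ℝ) x).quasiMeasurePreserving.ae
        ((ae_restrict_iff' measurableSet_Ioi).1 (hshift y hy))
    rw [Filter.EventuallyEq, ae_restrict_iff' measurableSet_Ioi]
    filter_upwards [h1] with t ht ht0
    rw [← add_assoc, ht (add_pos_of_pos_of_nonneg ht0 hx), mul_assoc]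
  obtain ⟨c, hc⟩ := eq_exp_of_differentiable_of_mul (k := fun δ => K δ / I) (hKdiff.div_const I)
    (by rw [hK0, div_self hgI]) hmul
  obtain ⟨A, hA⟩ := ae_eq_const_of_translation_invariant
    (L := fun s => G s * Complex.exp (-(c * s)))
    (hG.mul (Continuous.stronglyMeasurable (by fun_prop))) fun δ hδ => by
      filter_upwards [hshift δ hδ.le] with s hs
      rw [hs, hc δ hδ.le, mul_assoc, ← Complex.exp_add]
      congr 2
      push_cast
      ring
  refine ⟨A, c, ?_⟩
  filter_upwards [hA] with s hs
  rw [← hs, mul_assoc, ← Complex.exp_add]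
  simp

/-- The exponent of a square-integrable exponential on the half-line has negative real part. -/
theorem re_neg_of_memLp_exp {A c : ℂ} (hA : A ≠ 0)
    (h : MemLp (fun s : ℝ => A * Complex.exp (c * s)) 2 (volume.restrict (Set.Ioi (0 : ℝ)))) :
    c.re < 0 := by
  by_contra hc
  push Not at hc
  have hfin : ∫⁻ s in Set.Ioi (0 : ℝ), ‖A * Complex.exp (c * s)‖ₑ ^ 2 < ⊤ := by
    rw [← eLpNorm_two_sq]
    exact ENNReal.pow_lt_top h.2
  have hle : ∫⁻ s in Set.Ioi (0 : ℝ), ‖A‖ₑ ^ 2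
      ≤ ∫⁻ s in Set.Ioi (0 : ℝ), ‖A * Complex.exp (c * s)‖ₑ ^ 2 := by
    refine setLIntegral_mono' measurableSet_Ioi fun s hs => ?_
    gcongr
    rw [← ofReal_norm, ← ofReal_norm, norm_mul, Complex.norm_exp]
    refine ENNReal.ofReal_le_ofReal (le_mul_of_one_le_right (norm_nonneg _) (Real.one_le_exp ?_))
    simpa using mul_nonneg hc (le_of_lt hs)
  rw [lintegral_const, Measure.restrict_apply_univ, Real.volume_Ioi, ENNReal.mul_top (by simpa)]
    at hle
  exact absurd hfin (not_lt.2 hle)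

end FunctionalEquation

/-! ### Rigidity in the case of equality -/

section Rigidity

theorem circularDefect_congr {h h' : EuclideanSpace ℝ (Fin 2) → ℂ} (hh : h =ᵐ[volume] h') :
    circularDefect h = circularDefect h' := by
  have h1 := Measure.ae_ae_of_ae_prod
    (ae_sqPolarMeasure_iff.1 (measurePreserving_sqPolar.quasiMeasurePreserving.ae hh))
  rw [circularDefect, circularDefect]
  congr 1
  refine lintegral_congr_ae ?_
  filter_upwards [h1] with s hs
  refine lintegral_congr_ae ?_
  filter_upwards [hs] with θ hθ
  rw [hθ, average_congr hs]

theorem pairProduct_congr {d : ℕ} {F F' : EuclideanSpace ℝ (Fin d) → ℂ} (h : F =ᵐ[volume] F')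
    (p : EuclideanSpace ℝ (Fin d)) : pairProduct F p =ᵐ[volume] pairProduct F' p := by
  filter_upwards [(measurePreserving_add_left volume
      ((2⁻¹ : ℝ) • p)).quasiMeasurePreserving.ae h,
    (Measure.measurePreserving_sub_left volume
      ((2⁻¹ : ℝ) • p)).quasiMeasurePreserving.ae h] with q h1 h2
  rw [pairProduct, pairProduct, h1, h2]

theorem inner_sqPolar (P α s θ : ℝ) :
    inner ℝ (sqPolar (P, α)) (sqPolar (s, θ)) = √P * √s * Real.cos (θ - α) := by
  rw [PiLp.inner_apply, Fin.sum_univ_two, Real.cos_sub]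
  simp [sqPolar]
  ring

theorem norm_sq_halfSum_sqPolar {P s : ℝ} (hP : 0 ≤ P) (hs : 0 ≤ s) (α θ : ℝ) :
    ‖(2⁻¹ : ℝ) • sqPolar (P, α) + sqPolar (s, θ)‖ ^ 2
      = P / 4 + s + √P * √s * Real.cos (θ - α) := by
  rw [norm_add_sq_real, norm_smul, inner_smul_left, inner_sqPolar, mul_pow, norm_sq_sqPolar hP,
    norm_sq_sqPolar hs]
  norm_num
  ring

theorem norm_sq_halfDiff_sqPolar {P s : ℝ} (hP : 0 ≤ P) (hs : 0 ≤ s) (α θ : ℝ) :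
    ‖(2⁻¹ : ℝ) • sqPolar (P, α) - sqPolar (s, θ)‖ ^ 2
      = P / 4 + s - √P * √s * Real.cos (θ - α) := by
  rw [norm_sub_sq_real, norm_smul, inner_smul_left, inner_sqPolar, mul_pow, norm_sq_sqPolar hP,
    norm_sq_sqPolar hs]
  norm_num
  ring

/-- A property holding at `D cos(θ - α)` for almost every angle holds almost everywhere on
`(-D, D)`, since smooth maps send null sets to null sets. -/
theorem ae_of_ae_angle_cos {Q : ℝ → Prop} {D : ℝ} (hD : 0 < D) (α : ℝ)
    (h : ∀ᵐ θ ∂angleMeasure, Q (D * Real.cos (θ - α))) : ∀ᵐ v : ℝ, |v| < D → Q v := by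
  set N : Set ℝ := {θ | θ ∈ Set.Ioc (-Real.pi) Real.pi ∧ ¬ Q (D * Real.cos (θ - α))} with hN
  have hN0 : volume N = 0 := by
    have h1 : ∀ᵐ θ : ℝ, θ ∉ N := by
      filter_upwards [(ae_restrict_iff' measurableSet_Ioo).1 h, Measure.ae_ne volume Real.pi]
        with θ h2 h3 h4
      exact h4.2 (h2 ⟨h4.1.1, lt_of_le_of_ne h4.1.2 h3⟩)
    simpa [ae_iff] using h1
  have himg : volume ((fun θ => D * Real.cos (θ - α)) '' N) = 0 :=
    addHaar_image_eq_zero_of_differentiableOn_of_addHaar_eq_zero volume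
      (by fun_prop) hN0
  have hsub : {v : ℝ | ¬ (|v| < D → Q v)} ⊆ (fun θ => D * Real.cos (θ - α)) '' N := by
    intro v hv
    simp only [Set.mem_ofPred_eq, Classical.not_imp] at hv
    obtain ⟨hvD, hvQ⟩ := hv
    set θ := toIocMod Real.two_pi_pos (-Real.pi) (α + Real.arccos (v / D)) with hθ
    have hcos : D * Real.cos (θ - α) = v := by
      have h1 : θ - α = Real.arccos (v / D)
          - (toIocDiv Real.two_pi_pos (-Real.pi) (α + Real.arccos (v / D)) : ℤ) * (2 * Real.pi) := by
        rw [hθ, toIocMod, zsmul_eq_mul]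
        ring
      have h2 := abs_lt.1 hvD
      rw [h1, Real.cos_sub_int_mul_two_pi, Real.cos_arccos]
      · field_simp
      · rw [le_div_iff₀ hD]; linarith
      · rw [div_le_iff₀ hD]; linarith
    refine ⟨θ, ⟨?_, by rwa [hcos]⟩, hcos⟩
    have := toIocMod_mem_Ioc Real.two_pi_pos (-Real.pi) (α + Real.arccos (v / D))
    rwa [show -Real.pi + 2 * Real.pi = Real.pi by ring] at this
  exact measure_mono_null hsub himg

variable {G : ℝ → ℂ}

/-- If `|p|² = P`, `|q|² = s` and `θ` is the angle from `p` to `q`, then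
`|p/2 ± q|² = P/4 + s ± √P √s cos θ`, so constancy in the angle of `q` is constancy in
`v = √P √s cos θ`. -/
theorem ae_exists_const_of_circularDefect_eq_zero {F : EuclideanSpace ℝ (Fin 2) → ℂ}
    (hF : StronglyMeasurable F) (hFG : ∀ x, F x = G (‖x‖ ^ 2))
    (h : ∀ᵐ p, circularDefect (pairProduct F p) = 0) :
    ∀ᵐ P ∂(volume.restrict (Set.Ioi (0 : ℝ))), ∀ᵐ s ∂(volume.restrict (Set.Ioi (0 : ℝ))),
      ∃ c, ∀ᵐ v : ℝ, |v| < √P * √s → G (P / 4 + s + v) * G (P / 4 + s - v) = c := by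
  have h1 := Measure.ae_ae_of_ae_prod
    (ae_sqPolarMeasure_iff.1 (measurePreserving_sqPolar.quasiMeasurePreserving.ae h))
  filter_upwards [h1, ae_restrict_mem measurableSet_Ioi] with P hP hP0
  obtain ⟨α, hα⟩ := hP.exists
  rw [circularDefect_eq_zero_iff (stronglyMeasurable_pairProduct_left hF _)] at hα
  filter_upwards [hα, ae_restrict_mem measurableSet_Ioi] with s hs hs0
  refine ⟨_, ae_of_ae_angle_cos (mul_pos (Real.sqrt_pos.2 hP0) (Real.sqrt_pos.2 hs0)) α
    (Q := fun v => G (P / 4 + s + v) * G (P / 4 + s - v) =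
      ⨍ φ, pairProduct F (sqPolar (P, α)) (sqPolar (s, φ)) ∂angleMeasure) ?_⟩
  refine hs.mono fun θ hθ => ?_
  rw [← hθ, pairProduct, hFG, hFG, norm_sq_halfSum_sqPolar (le_of_lt hP0) (le_of_lt hs0),
    norm_sq_halfDiff_sqPolar (le_of_lt hP0) (le_of_lt hs0)]

/-- With `S = P/4 + s` fixed, the intervals `|v| < √P √s` exhaust `|v| < S`, and the constants on
overlapping intervals agree. A countable dense set of values of `P` suffices, so that the
exceptional set of `S` is null. -/
theorem ae_exists_const_of_ae_ae
    (h : ∀ᵐ P ∂(volume.restrict (Set.Ioi (0 : ℝ))), ∀ᵐ s ∂(volume.restrict (Set.Ioi (0 : ℝ))),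
      ∃ c, ∀ᵐ v : ℝ, |v| < √P * √s → G (P / 4 + s + v) * G (P / 4 + s - v) = c) :
    ∀ᵐ S ∂(volume.restrict (Set.Ioi (0 : ℝ))),
      ∃ c, ∀ᵐ v : ℝ, |v| < S → G (S + v) * G (S - v) = c := by
  have h1 : ∀ᵐ P : ℝ, 0 < P → ∀ᵐ S : ℝ, P / 4 < S →
      ∃ c, ∀ᵐ v : ℝ, |v| < √P * √(S - P / 4) → G (S + v) * G (S - v) = c := by
    filter_upwards [(ae_restrict_iff' measurableSet_Ioi).1 h] with P hP hP0
    have h2 := (measurePreserving_sub_right (volume : Measure ℝ) (P / 4)).quasiMeasurePreserving.ae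
      ((ae_restrict_iff' measurableSet_Ioi).1 (hP hP0))
    filter_upwards [h2] with S hS hlt
    simpa using hS (sub_pos.2 hlt)
  obtain ⟨T, hTsub, hTc, hTd⟩ := (Measure.dense_of_ae h1).exists_countable_dense_subset
  have h3 : ∀ᵐ S : ℝ, ∀ P ∈ T, 0 < P → P / 4 < S →
      ∃ c, ∀ᵐ v : ℝ, |v| < √P * √(S - P / 4) → G (S + v) * G (S - v) = c := by
    rw [ae_ball_iff hTc]
    intro P hP
    by_cases hP0 : 0 < P
    · filter_upwards [hTsub hP hP0] with S hS _ using hS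
    · exact Filter.Eventually.of_forall fun S h0 => absurd h0 hP0
  rw [ae_restrict_iff' measurableSet_Ioi]
  filter_upwards [h3] with S hS hS0
  have hS0 : 0 < S := hS0
  -- The radius `√P √(S - P/4)` takes its maximal value `S` at `P = 2S`.
  have hD : ∀ D < S, ∃ c, ∀ᵐ v : ℝ, |v| < D → G (S + v) * G (S - v) = c := by
    intro D hDS
    have hopen : IsOpen {P : ℝ | 0 < P ∧ P / 4 < S ∧ D < √P * √(S - P / 4)} :=
      (isOpen_lt (by fun_prop) (by fun_prop)).and ((isOpen_lt (by fun_prop) (by fun_prop)).and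
        (isOpen_lt (by fun_prop) (by fun_prop)))
    obtain ⟨P, hP, hPT⟩ := hTd.exists_mem_open hopen ⟨2 * S, by positivity, by linarith, by
      rw [← Real.sqrt_mul (by positivity), show 2 * S * (S - 2 * S / 4) = S ^ 2 by ring,
        Real.sqrt_sq hS0.le]
      exact hDS⟩
    obtain ⟨c, hc⟩ := hS P hP hPT.1 hPT.2.1
    exact ⟨c, hc.mono fun v hv hvD => hv (hvD.trans hPT.2.2)⟩
  obtain ⟨c, hc⟩ := hD (S / 2) (by linarith)
  refine ⟨c, ?_⟩
  obtain ⟨D, -, hDlt, hDlim⟩ := exists_seq_strictMono_tendsto S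
  have h4 : ∀ n, ∀ᵐ v : ℝ, |v| < D n → G (S + v) * G (S - v) = c := by
    intro n
    by_cases hn : 0 < D n
    · obtain ⟨c', hc'⟩ := hD (D n) (hDlt n)
      have hm : 0 < min (D n) (S / 2) := lt_min hn (by linarith)
      have hne : NeZero (volume.restrict (Set.Ioo (0 : ℝ) (min (D n) (S / 2)))) := ⟨by
        rw [Ne, Measure.restrict_eq_zero, Real.volume_Ioo]
        simpa using hm⟩
      obtain ⟨v, ⟨hv1, hv2⟩, hv⟩ := (((ae_restrict_of_ae hc).and (ae_restrict_of_ae hc')).and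
        (ae_restrict_mem (measurableSet_Ioo (a := (0 : ℝ)) (b := min (D n) (S / 2))))).exists
      have hv' : |v| < min (D n) (S / 2) := by rw [abs_of_pos hv.1]; exact hv.2
      have hcc : c' = c := by
        rw [← hv1 (hv'.trans_le (min_le_right _ _)), hv2 (hv'.trans_le (min_le_left _ _))]
      rwa [← hcc]
    · exact Filter.Eventually.of_forall fun v hv =>
        absurd ((abs_nonneg v).trans_lt hv) hn
  filter_upwards [ae_all_iff.2 h4] with v hv hvS
  obtain ⟨n, hn⟩ := (hDlim.eventually_const_lt hvS).exists
  exact hv n hn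

/-- Both products have argument sum `s + t + δ`, so each equals the constant attached to half that
sum. -/
theorem ae_ae_shift_of_ae_exists_const (hG : StronglyMeasurable G)
    (h : ∀ᵐ S ∂(volume.restrict (Set.Ioi (0 : ℝ))),
      ∃ c, ∀ᵐ v : ℝ, |v| < S → G (S + v) * G (S - v) = c) {δ : ℝ} (hδ : 0 < δ) :
    ∀ᵐ s ∂(volume.restrict (Set.Ioi (0 : ℝ))), ∀ᵐ t ∂(volume.restrict (Set.Ioi (0 : ℝ))),
      G (s + δ) * G t = G s * G (t + δ) := by
  have hqmp : Measure.QuasiMeasurePreserving (fun p : ℝ => 2⁻¹ * p + δ / 2) volume volume := by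
    refine (measurePreserving_add_right (volume : Measure ℝ)
      (δ / 2)).quasiMeasurePreserving.comp ⟨measurable_const_mul _, ?_⟩
    rw [Real.map_volume_mul_left (by norm_num)]
    exact Measure.smul_absolutelyContinuous
  have h1 : ∀ᵐ p : ℝ, ∀ᵐ q : ℝ, 0 < (2⁻¹ : ℝ) • p + q → 0 < (2⁻¹ : ℝ) • p - q →
      G ((2⁻¹ : ℝ) • p + q + δ) * G ((2⁻¹ : ℝ) • p - q)
        = G ((2⁻¹ : ℝ) • p + q) * G ((2⁻¹ : ℝ) • p - q + δ) := by
    filter_upwards [hqmp.ae ((ae_restrict_iff' measurableSet_Ioi).1 h)] with p hp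
    by_cases hp0 : 0 < p
    · obtain ⟨c, hc⟩ := hp (Set.mem_Ioi.2 (by positivity))
      filter_upwards [(measurePreserving_add_right (volume : Measure ℝ)
          (δ / 2)).quasiMeasurePreserving.ae hc,
        (measurePreserving_sub_right (volume : Measure ℝ)
          (δ / 2)).quasiMeasurePreserving.ae hc] with q hq1 hq2 h3 h4
      simp only [smul_eq_mul] at h3 h4 ⊢
      have h5 := hq1 (abs_lt.2 ⟨by linarith, by linarith⟩)
      have h6 := hq2 (abs_lt.2 ⟨by linarith, by linarith⟩)
      rw [show 2⁻¹ * p + δ / 2 + (q + δ / 2) = 2⁻¹ * p + q + δ by ring,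
        show 2⁻¹ * p + δ / 2 - (q + δ / 2) = 2⁻¹ * p - q by ring] at h5
      rw [show 2⁻¹ * p + δ / 2 + (q - δ / 2) = 2⁻¹ * p + q by ring,
        show 2⁻¹ * p + δ / 2 - (q - δ / 2) = 2⁻¹ * p - q + δ by ring] at h6
      rw [h5, h6]
    · refine Filter.Eventually.of_forall fun q h3 h4 => ?_
      simp only [smul_eq_mul] at h3 h4
      exact absurd (by linarith) hp0
  have hGm := hG.measurable
  have hms : MeasurableSet {w : ℝ × ℝ | 0 < w.1 → 0 < w.2 →
      G (w.1 + δ) * G w.2 = G w.1 * G (w.2 + δ)} := by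
    have : {w : ℝ × ℝ | 0 < w.1 → 0 < w.2 → G (w.1 + δ) * G w.2 = G w.1 * G (w.2 + δ)}
        = {w : ℝ × ℝ | 0 < w.1}ᶜ ∪ ({w : ℝ × ℝ | 0 < w.2}ᶜ ∪
          {w : ℝ × ℝ | G (w.1 + δ) * G w.2 = G w.1 * G (w.2 + δ)}) := by
      ext w; simp [imp_iff_not_or]
    rw [this]
    exact (measurableSet_lt measurable_const measurable_fst).compl.union
      ((measurableSet_lt measurable_const measurable_snd).compl.union
        (measurableSet_eq_fun (by fun_prop) (by fun_prop)))
  have hmp := measurePreserving_halfSum_diff (volume : Measure ℝ)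
  have h2 : ∀ᵐ w : ℝ × ℝ ∂(volume.prod volume), 0 < w.1 → 0 < w.2 →
      G (w.1 + δ) * G w.2 = G w.1 * G (w.2 + δ) := by
    rw [← hmp.map_eq, ae_map_iff hmp.measurable.aemeasurable hms]
    exact (Measure.ae_prod_mem_iff_ae_ae_mem (hmp.measurable hms)).2 h1
  rw [ae_restrict_iff' measurableSet_Ioi]
  filter_upwards [Measure.ae_ae_of_ae_prod h2] with s hs hs0
  rw [ae_restrict_iff' measurableSet_Ioi]
  filter_upwards [hs] with t ht ht0 using ht hs0 ht0

theorem memLp_profile (hG : StronglyMeasurable G)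
    (h : MemLp (fun x : EuclideanSpace ℝ (Fin 2) => G (‖x‖ ^ 2)) 2) :
    MemLp G 2 (volume.restrict (Set.Ioi (0 : ℝ))) := by
  refine ⟨hG.aestronglyMeasurable, ?_⟩
  have h1 := ENNReal.pow_lt_top (n := 2) h.2
  have hGm := hG.measurable
  rw [eLpNorm_two_sq, lintegral_eq_sqPolar (by fun_prop)] at h1
  have h2 : ∫⁻ s in Set.Ioi (0 : ℝ), ∫⁻ θ, ‖G (‖sqPolar (s, θ)‖ ^ 2)‖ₑ ^ 2 ∂angleMeasure
      = (∫⁻ s in Set.Ioi (0 : ℝ), ‖G s‖ₑ ^ 2) * angleMeasure Set.univ := by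
    rw [← lintegral_mul_const' _ _ (measure_ne_top _ _)]
    refine setLIntegral_congr_fun measurableSet_Ioi fun s hs => ?_
    simp only [norm_sq_sqPolar (le_of_lt hs)]
    rw [lintegral_const]
  rw [h2, ← eLpNorm_two_sq] at h1
  by_contra hcon
  rw [not_lt, top_le_iff] at hcon
  rw [hcon, ENNReal.top_pow two_ne_zero, ENNReal.top_mul (NeZero.ne _), ENNReal.mul_top (by simp)]
    at h1
  exact lt_irrefl _ h1

theorem exists_gaussian_of_circularDefect_eq_zero {F : EuclideanSpace ℝ (Fin 2) → ℂ}
    (hF : MemLp F 2) (hG : StronglyMeasurable G) (hFG : ∀ᵐ x, F x = G (‖x‖ ^ 2))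
    (h : ∀ᵐ p, circularDefect (pairProduct F p) = 0) :
    ∃ A B : ℂ, 0 < B.re ∧
      F =ᵐ[volume] fun x => A * Complex.exp (-B * ((‖x‖ : ℝ) : ℂ) ^ 2) := by
  have hGm := hG.measurable
  have htransfer : ∀ A c : ℂ, (∀ᵐ s ∂(volume.restrict (Set.Ioi (0 : ℝ))),
      G s = A * Complex.exp (c * s)) →
      F =ᵐ[volume] fun x => A * Complex.exp (-(-c) * ((‖x‖ : ℝ) : ℂ) ^ 2) := by
    intro A c hAc
    have h1 : ∀ᵐ x : EuclideanSpace ℝ (Fin 2),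
        G (‖x‖ ^ 2) = A * Complex.exp (c * ((‖x‖ ^ 2 : ℝ) : ℂ)) := by
      refine ae_of_ae_sqPolar (measurableSet_eq_fun (by fun_prop) (by fun_prop)) ?_
      have hm : MeasurableSet {z : ℝ × ℝ | 0 < z.1 ∧ G z.1 = A * Complex.exp (c * z.1)} :=
        (measurableSet_lt measurable_const measurable_fst).inter
          (measurableSet_eq_fun (by fun_prop) (by fun_prop))
      have h2 := (Measure.ae_prod_mem_iff_ae_ae_mem (ν := angleMeasure) hm).2 (by
        filter_upwards [hAc, ae_restrict_mem measurableSet_Ioi] with s hs hs0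
        exact Filter.Eventually.of_forall fun _ => ⟨hs0, hs⟩)
      filter_upwards [h2] with z hz
      have := norm_sq_sqPolar hz.1.le z.2
      rw [Prod.mk.eta] at this
      rw [this]
      exact hz.2
    filter_upwards [hFG, h1] with x hx hx'
    rw [hx, hx', neg_neg, Complex.ofReal_pow]
  by_cases hne : ∀ᵐ s ∂(volume.restrict (Set.Ioi (0 : ℝ))), G s = 0
  · refine ⟨0, 1, by simp, ?_⟩
    have := htransfer 0 (-1) (by filter_upwards [hne] with s hs; simp [hs])
    simpa using this
  have h0 : ∀ᵐ p : EuclideanSpace ℝ (Fin 2),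
      circularDefect (pairProduct (fun x => G (‖x‖ ^ 2)) p) = 0 := by
    filter_upwards [h] with p hp
    rw [← circularDefect_congr (pairProduct_congr hFG p), hp]
  have hG2 : MemLp G 2 (volume.restrict (Set.Ioi (0 : ℝ))) :=
    memLp_profile hG ((memLp_congr_ae hFG).1 hF)
  obtain ⟨A, c, hAc⟩ := ae_eq_const_mul_exp_of_shift hG hG2 hne fun δ hδ =>
    ae_ae_shift_of_ae_exists_const hG
      (ae_exists_const_of_ae_ae (ae_exists_const_of_circularDefect_eq_zero
        (hG.comp_measurable (by fun_prop)) (fun _ => rfl) h0)) hδ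
  have hA : A ≠ 0 := fun hA => hne (hAc.mono fun s hs => by rw [hs, hA, zero_mul])
  have hc := re_neg_of_memLp_exp hA ((memLp_congr_ae hAc).1 hG2)
  exact ⟨A, -c, by simpa using hc, htransfer A c hAc⟩

end Rigidity

theorem mainTheorem2
    (f : Lp ℂ 2 (volume : Measure (EuclideanSpace ℝ (Fin 2)))) (hf : IsRadial f) :
    (∃ U : EuclideanSpace ℝ (Fin 2) × ℝ → ℂ, IsSchrodingerEvolution f U) ∧
    ∀ U : EuclideanSpace ℝ (Fin 2) × ℝ → ℂ, IsSchrodingerEvolution f U →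
      eLpNorm U 4 volume ≤ ENNReal.ofReal ((2 : ℝ) ^ (-(1 / 2) : ℝ)) * eLpNorm f 2 volume ∧
      (eLpNorm U 4 volume = ENNReal.ofReal ((2 : ℝ) ^ (-(1 / 2) : ℝ)) * eLpNorm f 2 volume ↔
        ∃ A B : ℂ, 0 < B.re ∧
          f =ᵐ[volume] fun x => A * Complex.exp (-B * ((‖x‖ : ℝ) : ℂ) ^ 2)) := by
  refine ⟨exists_isSchrodingerEvolution f, fun U hU => ?_⟩
  obtain ⟨hle, hiff⟩ := strichartz_le_and_eq_iff f hU
  refine ⟨hle, hiff.trans ⟨fun h => ?_, ?_⟩⟩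
  · obtain ⟨G, hG, hFG⟩ := exists_radial_profile_of_isRadial hf
    obtain ⟨A, B, hB, hF⟩ := exists_gaussian_of_circularDefect_eq_zero (Lp.memLp _) hG hFG h
    have := fourierInv_Lp_gaussian _ hB hF
    rwa [fourierInv_fourier_eq f] at this
  · rintro ⟨A, B, hB, hfg⟩
    obtain ⟨A', B', -, hF⟩ := fourier_Lp_gaussian f hB hfg
    exact Filter.Eventually.of_forall fun p =>
      circularDefect_pairProduct_gaussian (Lp.stronglyMeasurable _) hF p
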